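/- Let $S$ be a finite (unrooted) tree with $n\ge 1$ nodes. A *search tree on $S$* (STT) is a rooted tree $T$ with the same node set as $S$ such that for every child $x$ of the root $r$ of $T$, the subtree $T_x$ is (recursively) a search tree on a connected component of $S\setminus r$ (each component occurring for exactly one child). The *convex hull* $\mathrm{ch}(A)$ of a node set $A$ is the subtree of $S$ induced by the union of all paths between nodes of $A$; $A$ is *Steiner-closed* if every node of $\mathrm{ch}(A)\setminus A$ is adjacent to exactly two nodes of $\mathrm{ch}(A)$. An STT $T$ is *Steiner-closed* if for every node $x$ the set of nodes on the path from the root of $T$ to $x$ is Steiner-closed. A *rotation* at a non-root node $x$ of $T$ with parent $p$ makes $x$ take the place of $p$ and makes $p$ a child of $x$; a child $y$ of $x$ whose subtree $T_y$ contains a node adjacent to $p$ in $S$ becomes a child of $p$; all other nodes keep their parents. Let $T$ and $T'$ be two Steiner-closed STTs on $S$. 1. If $n\ge 2$, then $T$ can be transformed into $T'$ by a sequence of at most $3n-5$ rotations such that all intermediate trees are Steiner-closed STTs on $S$. (If $n=1$, then $T=T'$.) 2. Starting with a pointer at the root of $T$, one can transform $T$ into $T'$ by a sequence of $O(n)$ steps,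 each of which either moves the pointer from the current node to its parent or to one of its children, or rotates at the node at the pointer (the pointer staying at this node); again all intermediate trees are Steiner-closed STTs on $S$. The constant in $O(n)$ is absolute. -/

import Mathlib

namespace STT

/-- A rooted tree with node set `V`, given by its root and its parent map. The parent map is
extended to the root by `parent root = root`; every node reaches the root by following parents. -/
@[ext]
structure RootedTree (V : Type*) where
  root : V
  parent : V → V
  parent_root : parent root = root
  reaches_root : ∀ v, ∃ k : ℕ, parent^[k] v = root

namespace RootedTree

variable {V : Type*} (T : RootedTree V)

/-- `y` is a child of `x` in `T`. -/
def IsChild (y x : V) : Prop := y ≠ T.root ∧ T.parent y = x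

/-- The node set of the subtree `T_x`: all descendants of `x`, including `x`. -/
def subtree (x : V) : Set V := {y | ∃ k : ℕ, T.parent^[k] y = x}

/-- The node set of the search path of `x`: all ancestors of `x`, including `x` and the root. -/
def searchPath (x : V) : Set V := {y | ∃ k : ℕ, T.parent^[k] x = y}

end RootedTree

/-- `C` is the node set of a connected component of the induced subgraph `S[B]`. -/
def IsComponentOf {V : Type*} (S : SimpleGraph V) (B C : Set V) : Prop :=
  ∃ c : (S.induce B).ConnectedComponent, C = Subtype.val '' c.supp

/-- The subtree `T_r` is a search tree on `S[A]`: its node set is `A`, and for every child `x` of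
its root `r`, the subtree `T_x` is a search tree on a connected component of `S[A] \ r`.
(The node sets of the subtrees at the children of `r` partition `A \ {r}`, hence every component
occurs, for exactly one child.) -/
inductive IsSearchTreeOn {V : Type*} (S : SimpleGraph V) (T : RootedTree V) : V → Set V → Prop
  | mk (r : V) (A : Set V)
      (nodes : T.subtree r = A)
      (component : ∀ x, T.IsChild x r → IsComponentOf S (A \ {r}) (T.subtree x))
      (recurse : ∀ x, T.IsChild x r → IsSearchTreeOn S T x (T.subtree x)) :
      IsSearchTreeOn S T r A

/-- `T` is a search tree on the tree `S` (an STT on `S`). -/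
def IsSTT {V : Type*} (S : SimpleGraph V) (T : RootedTree V) : Prop :=
  IsSearchTreeOn S T T.root Set.univ

/-- The node set of the convex hull of `A`: the union of all paths of `S` between nodes of `A`. -/
def hull {V : Type*} (S : SimpleGraph V) (A : Set V) : Set V :=
  {v | ∃ a ∈ A, ∃ b ∈ A, ∃ p : S.Walk a b, p.IsPath ∧ v ∈ p.support}

/-- `A` is Steiner-closed: every node of `hull A` outside `A` is adjacent to exactly two nodes
of `hull A`. -/
def IsSteinerClosedSet {V : Type*} (S : SimpleGraph V) (A : Set V) : Prop :=
  ∀ v ∈ hull S A \ A, {w | w ∈ hull S A ∧ S.Adj v w}.ncard = 2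

/-- `T` is a Steiner-closed STT on `S`: an STT all of whose search paths are Steiner-closed. -/
def IsSteinerClosedSTT {V : Type*} (S : SimpleGraph V) (T : RootedTree V) : Prop :=
  IsSTT S T ∧ ∀ x, IsSteinerClosedSet S (T.searchPath x)

/-- `T'` results from `T` by the rotation at the non-root node `x`, i.e. the rotation of the edge
between `x` and its parent `p = T.parent x`. -/
structure IsRotation {V : Type*} (S : SimpleGraph V) (T : RootedTree V) (x : V)
    (T' : RootedTree V) : Prop where
  /-- `x` has a parent in `T`. -/
  ne_root : x ≠ T.root
  /-- `p` becomes a child of `x`. -/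
  parent_old : T'.parent (T.parent x) = x
  /-- `x` takes the place of `p`, if `p` is the root. -/
  place_root : T.parent x = T.root → T'.root = x
  /-- `x` takes the place of `p`, if `p` is not the root. -/
  place_inner : T.parent x ≠ T.root →
    T'.root = T.root ∧ T'.parent x = T.parent (T.parent x)
  /-- A child `y` of `x` whose subtree contains a node adjacent to `p` in `S` becomes a
  child of `p`. -/
  moved : ∀ y, T.IsChild y x → (∃ z ∈ T.subtree y, S.Adj (T.parent x) z) →
    T'.parent y = T.parent x
  /-- All other nodes keep their parent. -/
  kept : ∀ y, y ≠ x → y ≠ T.parent x →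
    ¬ (T.IsChild y x ∧ ∃ z ∈ T.subtree y, S.Adj (T.parent x) z) → T'.parent y = T.parent y

/-- One unit-cost step of the pointer model, on pairs of a search tree and the node at the
pointer: move the pointer to the parent or to a child, or rotate the edge between the node at the
pointer and its parent. -/
inductive PointerStep {V : Type*} (S : SimpleGraph V) :
    RootedTree V × V → RootedTree V × V → Prop
  | up (T : RootedTree V) (x : V) (hx : x ≠ T.root) : PointerStep S (T, x) (T, T.parent x)
  | down (T : RootedTree V) (x y : V) (hy : T.IsChild y x) : PointerStep S (T, x) (T, y)
  | rotate (T T' : RootedTree V) (x : V) (h : IsRotation S T x T') :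
      PointerStep S (T, x) (T', x)

end STT

/-! An STT on `S` is Steiner-closed iff every subtree `T_x` has at most two boundary nodes, that is,
nodes outside of it adjacent in `S` to a node of it (`isSteinerClosedSTT_iff`). Boundary nodes of
`T_x` are proper ancestors of `x`, and the parent of `x` is one of them. Call `x` wide if `T_x` has
more than one boundary node, narrow otherwise.

A rotation at `x` with parent `p` hands the boundary of `p` on to `x`; the new boundary of `p`
consists of `x` and some old boundary nodes of `p`. The two-boundary property therefore survives if
`p` is narrow or `x` is wide (`IsTwoCut.rotate`). If `p` is narrow and `x` is wide, both nodes
become narrow and no other boundary changes, so the number of wide nodes drops by exactly one.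
Repeating this removes all wide nodes, and it never changes the root, since children of the root are
narrow. Without wide nodes each parent is a neighbour in `S`, so the tree is `S` itself rooted at
the given root (`IsTwoCut.ext_of_narrow`).

Let `r` be the root of `T`. In `T'`, the node `r` can be made the root with one rotation per proper
ancestor, hence at most `n - 1` (`exists_trek_to_root`). Removing the wide nodes there and in `T`
costs at most `n - 2` rotations each, as the root and its children are narrow. Both trees arrive at
`S` rooted at `r`; reversing the part that starts at `T'` gives `(n - 2) + (n - 1) + (n - 2) = 3n -
5`. With a pointer, the wide nodes are removed during one depth-first tour of linear length
(`exists_trek_narrow`). -/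

namespace STT

/-! ### The ancestor order of a rooted tree -/

namespace RootedTree

variable {V : Type*} (T : RootedTree V)

theorem self_mem_subtree (x : V) : x ∈ T.subtree x := ⟨0, rfl⟩

variable {T}

theorem subtree_trans {a b c : V} (h : a ∈ T.subtree b) (h' : b ∈ T.subtree c) :
    a ∈ T.subtree c := by
  obtain ⟨k, rfl⟩ := h
  obtain ⟨l, rfl⟩ := h'
  exact ⟨l + k, Function.iterate_add_apply _ _ _ _⟩

theorem subtree_subset {a b : V} (h : a ∈ T.subtree b) : T.subtree a ⊆ T.subtree b :=
  fun _ hy => subtree_trans hy h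

variable (T)

theorem iterate_root (k : ℕ) : T.parent^[k] T.root = T.root :=
  Function.iterate_fixed T.parent_root k

theorem mem_subtree_root (x : V) : x ∈ T.subtree T.root := T.reaches_root x

variable {T}

theorem root_mem_subtree {x : V} : T.root ∈ T.subtree x ↔ x = T.root := by
  constructor
  · rintro ⟨k, hk⟩
    rw [← hk, T.iterate_root]
  · rintro rfl
    exact T.self_mem_subtree _

/-- Otherwise `a` is a periodic point of the parent map. Some multiple of the period is long enough
to reach the root, where the iteration stays, so `a` is the root. -/
theorem subtree_antisymm {a b : V} (h : a ∈ T.subtree b) (h' : b ∈ T.subtree a) : a = b := by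
  obtain ⟨k, hk⟩ := h
  obtain ⟨l, hl⟩ := h'
  rcases Nat.eq_zero_or_pos (l + k) with h0 | hpos
  · obtain rfl : k = 0 := by omega
    exact hk
  · have hp : Function.IsFixedPt T.parent^[l + k] a := by
      rw [Function.IsFixedPt, Function.iterate_add_apply, hk, hl]
    obtain ⟨j, hj⟩ := T.reaches_root a
    have h1 : T.parent^[(l + k) * j] a = a := by
      rw [Function.iterate_mul]
      exact Function.iterate_fixed hp j
    have h2 : T.parent^[(l + k) * j] a = T.root := by
      obtain ⟨d, hd⟩ := Nat.exists_eq_add_of_le (Nat.le_mul_of_pos_left j hpos)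
      rw [hd, add_comm, Function.iterate_add_apply, hj, T.iterate_root]
    have ha : a = T.root := h1.symm.trans h2
    rw [← hk, ha, T.iterate_root]

theorem subtree_total {v a b : V} (ha : v ∈ T.subtree a) (hb : v ∈ T.subtree b) :
    a ∈ T.subtree b ∨ b ∈ T.subtree a := by
  obtain ⟨k, rfl⟩ := ha
  obtain ⟨l, rfl⟩ := hb
  rcases le_total k l with h | h
  · obtain ⟨d, rfl⟩ := Nat.exists_eq_add_of_le h
    exact Or.inl ⟨d, by rw [add_comm, Function.iterate_add_apply]⟩
  · obtain ⟨d, rfl⟩ := Nat.exists_eq_add_of_le h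
    exact Or.inr ⟨d, by rw [add_comm, Function.iterate_add_apply]⟩

theorem mem_subtree_iff {x y : V} : y ∈ T.subtree x ↔ y = x ∨ T.parent y ∈ T.subtree x := by
  constructor
  · rintro ⟨k, hk⟩
    cases k with
    | zero => exact Or.inl hk
    | succ k => exact Or.inr ⟨k, by rwa [Function.iterate_succ_apply] at hk⟩
  · rintro (rfl | ⟨k, hk⟩)
    · exact T.self_mem_subtree _
    · exact ⟨k + 1, by rwa [Function.iterate_succ_apply]⟩

theorem mem_subtree_of_parent {x y : V} (h : T.parent y ∈ T.subtree x) : y ∈ T.subtree x :=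
  mem_subtree_iff.2 (Or.inr h)

theorem parent_mem_subtree {x y : V} (h : y ∈ T.subtree x) (hne : y ≠ x) :
    T.parent y ∈ T.subtree x :=
  (mem_subtree_iff.1 h).resolve_left hne

variable (T) in
theorem mem_subtree_parent (x : V) : x ∈ T.subtree (T.parent x) :=
  mem_subtree_of_parent (T.self_mem_subtree _)

theorem parent_ne {x : V} (hx : x ≠ T.root) : T.parent x ≠ x := by
  intro h
  obtain ⟨k, hk⟩ := T.reaches_root x
  rw [Function.iterate_fixed h] at hk
  exact hx hk

theorem parent_notMem_subtree {x : V} (hx : x ≠ T.root) : T.parent x ∉ T.subtree x :=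
  fun h => parent_ne hx (subtree_antisymm h (T.mem_subtree_parent x))

/-- Induction from the root downwards: the claim at `y` may use all proper ancestors of `y`. -/
theorem ancestor_induction {P : V → Prop}
    (h : ∀ y, (∀ z, y ∈ T.subtree z → z ≠ y → P z) → P y) (y : V) : P y := by
  have key : ∀ k, ∀ y, T.parent^[k] y = T.root → ∀ z, y ∈ T.subtree z → P z := by
    intro k
    induction k with
    | zero =>
      intro y hy z hz
      obtain rfl : y = T.root := hy
      obtain rfl := root_mem_subtree.1 hz
      refine h _ fun z hz hne => absurd (root_mem_subtree.1 hz) hne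
    | succ k ih =>
      intro y hy z hz
      have ih' := ih (T.parent y) (by rwa [Function.iterate_succ_apply] at hy)
      rcases mem_subtree_iff.1 hz with rfl | hz
      · exact h _ fun z hz hne => ih' z (parent_mem_subtree hz hne.symm)
      · exact ih' z hz
  obtain ⟨k, hk⟩ := T.reaches_root y
  exact key k y hk y (T.self_mem_subtree y)

theorem parent_induction {P : V → Prop} (hroot : P T.root)
    (h : ∀ y, y ≠ T.root → P (T.parent y) → P y) (y : V) : P y := by
  refine ancestor_induction (T := T) (fun y ih => ?_) y
  by_cases hy : y = T.root
  · rwa [hy]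
  · exact h y hy (ih _ (T.mem_subtree_parent y) (parent_ne hy))

theorem IsChild.mem_subtree {c x : V} (h : T.IsChild c x) : c ∈ T.subtree x :=
  h.2 ▸ T.mem_subtree_parent c

theorem IsChild.ne {c x : V} (h : T.IsChild c x) : c ≠ x := by
  rintro rfl
  exact parent_ne h.1 h.2

theorem IsChild.notMem_subtree {c x : V} (h : T.IsChild c x) : x ∉ T.subtree c :=
  h.2 ▸ parent_notMem_subtree h.1

theorem isChild_parent {x : V} (hx : x ≠ T.root) : T.IsChild x (T.parent x) := ⟨hx, rfl⟩

theorem exists_isChild {x y : V} (h : y ∈ T.subtree x) (hne : y ≠ x) :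
    ∃ c, T.IsChild c x ∧ y ∈ T.subtree c := by
  induction y using parent_induction (T := T) with
  | hroot => exact absurd (root_mem_subtree.1 h).symm hne
  | h y hy ih =>
    by_cases hp : T.parent y = x
    · exact ⟨y, ⟨hy, hp⟩, T.self_mem_subtree y⟩
    · obtain ⟨c, hc, hyc⟩ := ih (parent_mem_subtree h hne) hp
      exact ⟨c, hc, mem_subtree_of_parent hyc⟩

theorem IsChild.eq_of_mem {c d x y : V} (hc : T.IsChild c x) (hd : T.IsChild d x)
    (hyc : y ∈ T.subtree c) (hyd : y ∈ T.subtree d) : c = d := by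
  by_contra hne
  rcases subtree_total hyc hyd with h | h
  · exact hd.notMem_subtree (hc.2 ▸ parent_mem_subtree h hne)
  · exact hc.notMem_subtree (hd.2 ▸ parent_mem_subtree h (Ne.symm hne))

theorem IsChild.mem_of_ancestor {c x a : V} (hc : T.IsChild c x) (h : c ∈ T.subtree a)
    (hne : c ≠ a) : x ∈ T.subtree a :=
  hc.2 ▸ parent_mem_subtree h hne

/-- Induction from the leaves upwards: the claim at `y` may use the children of `y`. -/
theorem descendant_induction [Finite V] {P : V → Prop}
    (h : ∀ y, (∀ c, T.IsChild c y → P c) → P y) (y : V) : P y := by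
  have key : ∀ n, ∀ y, (T.subtree y).ncard ≤ n → P y := by
    intro n
    induction n with
    | zero =>
      intro y hy
      have := (Set.ncard_pos (Set.toFinite _)).2 ⟨y, T.self_mem_subtree y⟩
      omega
    | succ n ih =>
      intro y hy
      refine h y fun c hc => ih c ?_
      have := Set.ncard_lt_ncard (s := T.subtree c) (t := T.subtree y)
        ⟨subtree_subset hc.mem_subtree, fun hs => hc.notMem_subtree (hs (T.self_mem_subtree y))⟩
        (Set.toFinite _)
      omega
  exact key _ y le_rfl

theorem mem_searchPath {x y : V} : y ∈ T.searchPath x ↔ x ∈ T.subtree y := Iff.rfl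

theorem searchPath_root : T.searchPath T.root = {T.root} := by
  ext y
  exact root_mem_subtree

theorem searchPath_eq_insert {x : V} : T.searchPath x = insert x (T.searchPath (T.parent x)) := by
  ext y
  simp only [Set.mem_insert_iff, mem_searchPath]
  rw [mem_subtree_iff, eq_comm]

theorem notMem_searchPath_parent {x : V} (hx : x ≠ T.root) : x ∉ T.searchPath (T.parent x) :=
  parent_notMem_subtree hx

theorem ncard_searchPath [Finite V] {x : V} (hx : x ≠ T.root) :
    (T.searchPath x).ncard = (T.searchPath (T.parent x)).ncard + 1 := by
  rw [searchPath_eq_insert, Set.ncard_insert_of_notMem (notMem_searchPath_parent hx)]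

end RootedTree

/-! ### Connections inside a node set -/

section Link

variable {V : Type*} {S : SimpleGraph V} {X Y : Set V} {a b c v w : V}

/-- `a` and `b` are joined by a walk of `S` inside `X` (or are equal). -/
def Link (S : SimpleGraph V) (X : Set V) : V → V → Prop :=
  Relation.ReflTransGen fun u v => S.Adj u v ∧ u ∈ X ∧ v ∈ X

theorem Link.refl : Link S X a a := Relation.ReflTransGen.refl

theorem Link.trans (h : Link S X a b) (h' : Link S X b c) : Link S X a c :=
  Relation.ReflTransGen.trans h h'

theorem Link.symm (h : Link S X a b) : Link S X b a := by
  induction h with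
  | refl => exact Link.refl
  | tail _ h ih => exact Relation.ReflTransGen.head ⟨h.1.symm, h.2.2, h.2.1⟩ ih

theorem Link.mono (h : Link S X a b) (hXY : X ⊆ Y) : Link S Y a b :=
  Relation.ReflTransGen.mono (fun _ _ h => ⟨h.1, hXY h.2.1, hXY h.2.2⟩) _ _ h

theorem Link.single (h : S.Adj a b) (ha : a ∈ X) (hb : b ∈ X) : Link S X a b :=
  Relation.ReflTransGen.single ⟨h, ha, hb⟩

/-- A link that starts in `Y` and ends outside `Y` has a first edge that leaves `Y`. -/
theorem Link.exists_exit (h : Link S X a b) (ha : a ∈ Y) (hb : b ∉ Y) :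
    ∃ s t, Link S (X ∩ Y) a s ∧ s ∈ Y ∧ s ∈ X ∧ t ∉ Y ∧ t ∈ X ∧ S.Adj s t := by
  have key : (b ∈ Y ∧ Link S (X ∩ Y) a b) ∨
      ∃ s t, Link S (X ∩ Y) a s ∧ s ∈ Y ∧ s ∈ X ∧ t ∉ Y ∧ t ∈ X ∧ S.Adj s t := by
    clear hb
    induction h with
    | refl => exact Or.inl ⟨ha, Link.refl⟩
    | @tail u w _ huw ih =>
      rcases ih with ⟨hu, hl⟩ | ih
      · by_cases hw : w ∈ Y
        · exact Or.inl ⟨hw, hl.trans (Link.single huw.1 ⟨huw.2.1, hu⟩ ⟨huw.2.2, hw⟩)⟩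
        · exact Or.inr ⟨u, w, hl, hu, huw.2.1, hw, huw.2.2, huw.1⟩
      · exact Or.inr ih
  exact key.resolve_left fun h => hb h.1

/-- A link either avoids `w` or reaches `w`. -/
theorem Link.avoid_or (h : Link S X a b) (w : V) :
    Link S (X \ {w}) a b ∨ Link S X a w := by
  induction h with
  | refl => exact Or.inl Link.refl
  | @tail u c hu huc ih =>
    rcases ih with ih | ih
    · by_cases h1 : u = w
      · exact Or.inr (h1 ▸ hu)
      · by_cases h2 : c = w
        · exact Or.inr (h2 ▸ Link.trans hu (Link.single huc.1 huc.2.1 huc.2.2))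
        · exact Or.inl (ih.trans (Link.single huc.1 ⟨huc.2.1, h1⟩ ⟨huc.2.2, h2⟩))
    · exact Or.inr ih

theorem link_of_walk (p : S.Walk a b) (hp : ∀ z ∈ p.support, z ∈ X) : Link S X a b := by
  induction p with
  | nil => exact Link.refl
  | cons h p ih =>
    simp only [SimpleGraph.Walk.support_cons, List.mem_cons, forall_eq_or_imp] at hp
    exact (Link.single h hp.1 (hp.2 _ p.start_mem_support)).trans (ih hp.2)

/-- In an acyclic graph, a node outside `X` has at most one neighbour in each connected piece
of `X`. -/
theorem Link.eq_of_adj (hS : S.IsAcyclic) (h : Link S X a b) (hv : v ∉ X) (ha : S.Adj v a)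
    (hb : S.Adj v b) : a = b := by
  -- The edge `va` is a bridge, but the link from `a` to `b` avoids `v` and closes up with the edge
  -- `bv` to a detour around it.
  by_contra hne
  have hbr := SimpleGraph.isAcyclic_iff_forall_adj_isBridge.1 hS ha
  rw [SimpleGraph.isBridge_iff] at hbr
  apply hbr
  have h1 : (S.deleteEdges {s(v, a)}).Adj v b := by
    rw [SimpleGraph.deleteEdges_adj]
    refine ⟨hb, ?_⟩
    simp only [Set.mem_singleton_iff, Sym2.eq_iff]
    rintro (⟨_, h⟩ | ⟨h, _⟩)
    · exact hne h.symm
    · exact ha.ne h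
  have h2 : (S.deleteEdges {s(v, a)}).Reachable b a := by
    have h' := h.symm
    clear h hb hne h1 hbr
    induction h' using Relation.ReflTransGen.head_induction_on with
    | refl => exact SimpleGraph.Reachable.refl _
    | head hu _ ih =>
      refine SimpleGraph.Reachable.trans (SimpleGraph.Adj.reachable ?_) ih
      rw [SimpleGraph.deleteEdges_adj]
      refine ⟨hu.1, ?_⟩
      simp only [Set.mem_singleton_iff, Sym2.eq_iff]
      rintro (⟨h, _⟩ | ⟨_, h⟩)
      · exact hv (h ▸ hu.2.1)
      · exact hv (h ▸ hu.2.2)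
  exact h1.reachable.trans h2

end Link

/-! ### Convex hulls and branches -/

section Tripod

variable {V : Type*} {S : SimpleGraph V} {A : Set V} {a b v w : V}

/-- `w` is a neighbour of `v`, and its branch at `v` contains a node of `A`. -/
def Branch (S : SimpleGraph V) (A : Set V) (v w : V) : Prop :=
  S.Adj v w ∧ ∃ a ∈ A, Link S {v}ᶜ w a

theorem mem_hull_of_mem (ha : a ∈ A) : a ∈ hull S A :=
  ⟨a, ha, a, ha, SimpleGraph.Walk.nil, by simp, by simp⟩

theorem mem_hull_of_not_link (hS : S.IsTree) (ha : a ∈ A) (hb : b ∈ A)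
    (h : ¬ Link S {v}ᶜ a b) : v ∈ hull S A := by
  obtain ⟨p, hp⟩ := hS.connected.exists_isPath a b
  refine ⟨a, ha, b, hb, p, hp, ?_⟩
  by_contra hv
  exact h (link_of_walk p fun z hz => by rintro rfl; exact hv hz)

theorem Branch.mem_hull (hS : S.IsTree) {w₁ w₂ : V} (h₁ : Branch S A v w₁)
    (h₂ : Branch S A v w₂) (hne : w₁ ≠ w₂) : v ∈ hull S A := by
  obtain ⟨hw₁, a₁, ha₁, hl₁⟩ := h₁
  obtain ⟨hw₂, a₂, ha₂, hl₂⟩ := h₂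
  refine mem_hull_of_not_link hS ha₁ ha₂ fun hl => hne ?_
  exact ((hl₁.trans hl).trans hl₂.symm).eq_of_adj hS.isAcyclic (by simp) hw₁ hw₂

/-- Unless `w₁` is in `A`, it separates `a₁` from `a₂`. A link between them avoiding `w₁` would
extend via `w₂` to `v` and enter `v` through a neighbour other than `w₁`; that neighbour is linked
to `w₁` off `v`, which is impossible in a tree. -/
theorem Branch.neighbor_mem_hull (hS : S.IsTree) (hv : v ∉ A) {w₁ w₂ : V}
    (h₁ : Branch S A v w₁) (h₂ : Branch S A v w₂) (hne : w₁ ≠ w₂) : w₁ ∈ hull S A := by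
  obtain ⟨hw₁, a₁, ha₁, hl₁⟩ := h₁
  obtain ⟨hw₂, a₂, ha₂, hl₂⟩ := h₂
  by_cases h1 : w₁ = a₁
  · exact h1 ▸ mem_hull_of_mem ha₁
  refine mem_hull_of_not_link hS ha₁ ha₂ fun hl => ?_
  have h2 : Link S {w₁}ᶜ w₂ a₂ := by
    rcases hl₂.avoid_or w₁ with h | h
    · exact h.mono fun z hz => hz.2
    · exact absurd (h.eq_of_adj hS.isAcyclic (by simp) hw₂ hw₁) hne.symm
  have h3 : Link S {w₁}ᶜ v w₂ := Link.single hw₂ hw₁.ne (Ne.symm hne)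
  have h4 : Link S {w₁}ᶜ a₁ v := hl.trans (h3.trans h2).symm
  obtain ⟨s, t, hs, -, hsX, ht, -, hst⟩ := h4.exists_exit (Y := {v}ᶜ)
    (by rintro rfl; exact hv ha₁) (by simp)
  obtain rfl : t = v := by simpa using ht
  have h5 : Link S {t}ᶜ w₁ s := hl₁.trans (hs.mono fun z hz => hz.2)
  exact hsX (h5.eq_of_adj hS.isAcyclic (by simp) hw₁ hst.symm).symm

/-- On a path through `w` with both ends in `A`, the node `v` lies on at most one side of `w`; the
other side leads to `A` without meeting `v`. -/
theorem branch_of_mem_hull (hv : v ∉ A) (hw : w ∈ hull S A) (h : S.Adj v w) :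
    Branch S A v w := by
  classical
  refine ⟨h, ?_⟩
  obtain ⟨a, ha, b, hb, p, hp, hwp⟩ := hw
  by_cases h1 : v ∈ (p.takeUntil w hwp).support
  · refine ⟨b, hb, link_of_walk (p.dropUntil w hwp) fun z hz => ?_⟩
    rintro rfl
    have hnd := hp.support_nodup
    rw [← p.take_spec hwp, SimpleGraph.Walk.support_append, List.nodup_append] at hnd
    refine hnd.2.2 _ h1 z ?_ rfl
    rw [SimpleGraph.Walk.mem_support_iff] at hz
    exact hz.resolve_left h.ne
  · refine ⟨a, ha, (link_of_walk (p.takeUntil w hwp) fun z hz => ?_).symm⟩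
    rintro rfl
    exact h1 hz

theorem exists_neighbors_of_mem_hull (hv : v ∈ hull S A) (hvA : v ∉ A) :
    ∃ w₁ w₂, w₁ ≠ w₂ ∧ S.Adj v w₁ ∧ S.Adj v w₂ ∧ w₁ ∈ hull S A ∧ w₂ ∈ hull S A := by
  classical
  obtain ⟨a, ha, b, hb, p, hp, hvp⟩ := hv
  have hsub : ∀ z ∈ p.support, z ∈ hull S A := fun z hz => ⟨a, ha, b, hb, p, hp, hz⟩
  have hnd := hp.support_nodup
  rw [← p.take_spec hvp, SimpleGraph.Walk.support_append, List.nodup_append] at hnd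
  have ht := p.support_takeUntil_subset_support hvp
  have hd := p.support_dropUntil_subset_support hvp
  generalize p.takeUntil v hvp = q at hnd ht
  generalize p.dropUntil v hvp = r at hnd hd
  -- The two neighbours are the predecessor and the successor of `v` on the path; reversing the
  -- first half makes the predecessor its second node.
  have hq : q.reverse.support ⊆ q.support := by simp
  generalize q.reverse = q' at hq
  cases q' with
  | nil => exact absurd ha hvA
  | @cons _ w₁ _ h₁ q' =>
    cases r with
    | nil => exact absurd hb hvA
    | @cons _ w₂ _ h₂ r =>
      have m₁ : w₁ ∈ q.support := hq (by simp)
      refine ⟨w₁, w₂, ?_, h₁, h₂, hsub _ (ht m₁), hsub _ (hd (by simp))⟩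
      exact hnd.2.2 _ m₁ _ (by simp)

/-- A set is Steiner-closed iff no node outside of it has three branches that meet the set. -/
theorem isSteinerClosedSet_iff [Finite V] (hS : S.IsTree) :
    IsSteinerClosedSet S A ↔ ∀ v ∉ A, ∀ w₁ w₂ w₃, Branch S A v w₁ → Branch S A v w₂ →
      Branch S A v w₃ → w₁ ≠ w₂ → w₁ ≠ w₃ → w₂ ≠ w₃ → False := by
  constructor
  · intro h v hv w₁ w₂ w₃ h₁ h₂ h₃ h12 h13 h23
    have h2 := h v ⟨h₁.mem_hull hS h₂ h12, hv⟩
    have h3 : ({w₁, w₂, w₃} : Set V).ncard = 3 :=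
      Set.ncard_eq_three.2 ⟨w₁, w₂, w₃, h12, h13, h23, rfl⟩
    have h4 := Set.ncard_le_ncard (s := {w₁, w₂, w₃}) (t := {w | w ∈ hull S A ∧ S.Adj v w})
      (by
        rintro z (rfl | rfl | rfl)
        · exact ⟨h₁.neighbor_mem_hull hS hv h₂ h12, h₁.1⟩
        · exact ⟨h₂.neighbor_mem_hull hS hv h₁ h12.symm, h₂.1⟩
        · exact ⟨h₃.neighbor_mem_hull hS hv h₁ h13.symm, h₃.1⟩) (Set.toFinite _)
    omega
  · rintro h v ⟨hv, hvA⟩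
    obtain ⟨w₁, w₂, hne, ha₁, ha₂, hw₁, hw₂⟩ := exists_neighbors_of_mem_hull hv hvA
    rw [Set.ncard_eq_two]
    refine ⟨w₁, w₂, hne, ?_⟩
    ext z
    simp only [Set.mem_ofPred_eq, Set.mem_insert_iff, Set.mem_singleton_iff]
    constructor
    · rintro ⟨hz, haz⟩
      by_contra hcon
      push Not at hcon
      exact h v hvA w₁ w₂ z (branch_of_mem_hull hvA hw₁ ha₁) (branch_of_mem_hull hvA hw₂ ha₂)
        (branch_of_mem_hull hvA hz haz) hne hcon.1.symm hcon.2.symm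
    · rintro (rfl | rfl)
      · exact ⟨hw₁, ha₁⟩
      · exact ⟨hw₂, ha₂⟩

end Tripod

end STT

/-! ### Search trees as elimination trees -/

namespace STT

open STT.RootedTree

section Component

variable {V : Type*} {S : SimpleGraph V} {B C : Set V}

theorem IsComponentOf.link (h : IsComponentOf S B C) {u v : V} (hu : u ∈ C) (hv : v ∈ C) :
    Link S C u v := by
  obtain ⟨c, rfl⟩ := h
  obtain ⟨u, hu, rfl⟩ := hu
  obtain ⟨v, hv, rfl⟩ := hv
  have hr : (S.induce B).Reachable u v := by
    rw [← SimpleGraph.ConnectedComponent.eq]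
    rw [SimpleGraph.ConnectedComponent.mem_supp_iff] at hu hv
    rw [hu, hv]
  obtain ⟨p⟩ := hr
  induction p with
  | nil => exact Link.refl
  | @cons a b d hab p ih =>
    have hb : b ∈ c.supp := by
      rw [SimpleGraph.ConnectedComponent.mem_supp_iff] at hu ⊢
      rw [← hu]
      exact (SimpleGraph.ConnectedComponent.connectedComponentMk_eq_of_adj hab).symm
    have hl : Link S (Subtype.val '' c.supp) (a : V) b :=
      Link.single (SimpleGraph.comap_adj.1 hab) ⟨a, hu, rfl⟩ ⟨b, hb, rfl⟩
    exact hl.trans (ih hb hv)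

theorem IsComponentOf.mem_of_adj (h : IsComponentOf S B C) {u v : V} (hu : u ∈ C) (hv : v ∈ B)
    (huv : S.Adj u v) : v ∈ C := by
  obtain ⟨c, rfl⟩ := h
  obtain ⟨u, hu, rfl⟩ := hu
  refine ⟨⟨v, hv⟩, ?_, rfl⟩
  rw [SimpleGraph.ConnectedComponent.mem_supp_iff] at hu ⊢
  rw [← hu]
  exact (SimpleGraph.ConnectedComponent.connectedComponentMk_eq_of_adj
    (SimpleGraph.comap_adj.2 huv)).symm

theorem isComponentOf_of_link {x : V} (hx : x ∈ C) (hCB : C ⊆ B)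
    (hl : ∀ v ∈ C, Link S C x v) (hcl : ∀ u ∈ C, ∀ v ∈ B, S.Adj u v → v ∈ C) :
    IsComponentOf S B C := by
  refine ⟨(S.induce B).connectedComponentMk ⟨x, hCB hx⟩, ?_⟩
  ext z
  simp only [Set.mem_image, SimpleGraph.ConnectedComponent.mem_supp_iff,
    SimpleGraph.ConnectedComponent.eq]
  constructor
  · intro hz
    refine ⟨⟨z, hCB hz⟩, ?_, rfl⟩
    have key : ∀ y, Link S C x y → ∀ hy : y ∈ B, (S.induce B).Reachable ⟨x, hCB hx⟩ ⟨y, hy⟩ := by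
      intro y h
      induction h with
      | refl => exact fun _ => SimpleGraph.Reachable.refl _
      | tail _ h ih =>
        exact fun hy => (ih (hCB h.2.1)).trans (SimpleGraph.Adj.reachable
          (SimpleGraph.comap_adj.2 h.1))
    exact (key z (hl z hz) (hCB hz)).symm
  · rintro ⟨y, hy, rfl⟩
    obtain ⟨p⟩ := hy.symm
    have key : ∀ a b : B, (S.induce B).Walk a b → (a : V) ∈ C → (b : V) ∈ C := by
      intro a b p
      induction p with
      | nil => exact id
      | cons h p ih =>
        exact fun ha => ih (hcl _ ha _ (Subtype.coe_prop _) (SimpleGraph.comap_adj.1 h))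
    exact key _ _ p hx

end Component

variable {V : Type*} {S : SimpleGraph V} {T : RootedTree V}

/-- The two conditions that characterise search trees on a tree `S`: edges of `S` join ancestors
to descendants, and all subtrees are connected in `S`. -/
structure IsElimination (S : SimpleGraph V) (T : RootedTree V) : Prop where
  comparable : ∀ u v, S.Adj u v → u ∈ T.subtree v ∨ v ∈ T.subtree u
  link : ∀ x, ∀ u ∈ T.subtree x, ∀ v ∈ T.subtree x, Link S (T.subtree x) u v

theorem IsSearchTreeOn.comparable {r : V} {A : Set V} (h : IsSearchTreeOn S T r A) :
    (∀ u ∈ A, ∀ v ∈ A, S.Adj u v → u ∈ T.subtree v ∨ v ∈ T.subtree u) ∧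
    ∀ x ∈ A, x ≠ r → ∀ u ∈ T.subtree x, ∀ v ∈ T.subtree x, Link S (T.subtree x) u v := by
  induction h with
  | mk r A nodes component _ ih =>
    subst nodes
    constructor
    · intro u hu v hv huv
      by_cases hur : u = r
      · exact Or.inr (hur ▸ hv)
      by_cases hvr : v = r
      · exact Or.inl (hvr ▸ hu)
      obtain ⟨c, hc, huc⟩ := exists_isChild hu hur
      exact (ih c hc).1 u huc v ((component c hc).mem_of_adj huc ⟨hv, hvr⟩ huv) huv
    · intro x hx hxr
      obtain ⟨c, hc, hxc⟩ := exists_isChild hx hxr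
      by_cases h : x = c
      · subst h
        exact fun u hu v hv => (component x hc).link hu hv
      · exact (ih c hc).2 x hxc h

theorem isSTT_iff [Finite V] (hS : S.IsTree) : IsSTT S T ↔ IsElimination S T := by
  constructor
  · intro h
    have hc := IsSearchTreeOn.comparable h
    refine ⟨fun u v => hc.1 u trivial v trivial, fun x => ?_⟩
    by_cases hx : x = T.root
    · subst hx
      intro u _ v _
      obtain ⟨p⟩ := hS.connected u v
      exact link_of_walk p fun z _ => T.mem_subtree_root z
    · exact hc.2 x trivial hx
  · intro h
    have key : ∀ x, IsSearchTreeOn S T x (T.subtree x) := by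
      intro x
      induction x using descendant_induction (T := T) with
      | h x ih =>
        refine ⟨x, _, rfl, fun c hc => ?_, ih⟩
        refine isComponentOf_of_link (T.self_mem_subtree c) ?_
          (h.link c c (T.self_mem_subtree c)) ?_
        · exact fun y hy => ⟨subtree_subset hc.mem_subtree hy, by
            rintro rfl; exact hc.notMem_subtree hy⟩
        -- An edge cannot lead from one child's subtree to another's, since its ends are comparable.
        · rintro u hu v ⟨hv, hvx⟩ huv
          rcases h.comparable u v huv with h1 | h1
          · obtain ⟨d, hd, hvd⟩ := exists_isChild hv hvx
            obtain rfl := hc.eq_of_mem hd hu (subtree_trans h1 hvd)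
            exact hvd
          · exact subtree_trans h1 hu
    have := key T.root
    rwa [show T.subtree T.root = Set.univ from Set.eq_univ_of_forall T.mem_subtree_root] at this

/-! ### Boundaries of subtrees and Steiner-closedness -/

/-- The nodes outside of the subtree `T_x` that are adjacent to it in `S`. -/
def boundary (S : SimpleGraph V) (T : RootedTree V) (x : V) : Set V :=
  {a | a ∉ T.subtree x ∧ ∃ w ∈ T.subtree x, S.Adj a w}

theorem boundary_root : boundary S T T.root = ∅ :=
  Set.eq_empty_of_forall_notMem fun a ha => ha.1 (T.mem_subtree_root a)

namespace IsElimination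

theorem mem_of_mem_boundary (h : IsElimination S T) {a x : V} (ha : a ∈ boundary S T x) :
    x ∈ T.subtree a := by
  obtain ⟨hax, w, hw, haw⟩ := ha
  rcases h.comparable a w haw with h1 | h1
  · exact absurd (subtree_trans h1 hw) hax
  · exact (subtree_total h1 hw).resolve_left hax

/-- The subtree of the parent is connected, so some edge inside it leaves `T_x`. The outer end of
that edge is a proper ancestor of `x` below or equal to the parent, hence the parent. -/
theorem parent_mem_boundary (h : IsElimination S T) {x : V} (hx : x ≠ T.root) :
    T.parent x ∈ boundary S T x := by
  obtain ⟨s, t, -, hs, -, ht, htp, hst⟩ := (h.link (T.parent x) x (T.mem_subtree_parent x)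
    (T.parent x) (T.self_mem_subtree _)).exists_exit (T.self_mem_subtree x)
    (parent_notMem_subtree hx)
  have hb : t ∈ boundary S T x := ⟨ht, s, hs, hst.symm⟩
  have hpt := parent_mem_subtree (h.mem_of_mem_boundary hb) (by
    rintro rfl; exact ht (T.self_mem_subtree _))
  rwa [← subtree_antisymm htp hpt]

theorem eq_or_mem_boundary (h : IsElimination S T) {a c x : V} (hc : T.IsChild c x)
    (ha : a ∈ boundary S T c) : a = x ∨ a ∈ boundary S T x := by
  by_cases hax : a = x
  · exact Or.inl hax
  have hca := h.mem_of_mem_boundary ha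
  obtain ⟨hac, w, hw, haw⟩ := ha
  have hxa : x ∈ T.subtree a := hc.mem_of_ancestor hca (by
    rintro rfl; exact hac (T.self_mem_subtree _))
  exact Or.inr ⟨fun hx => hax (subtree_antisymm hx hxa), w,
    subtree_subset hc.mem_subtree hw, haw⟩

theorem eq_of_adj (h : IsElimination S T) (hS : S.IsTree) {a u v x : V} (ha : a ∉ T.subtree x)
    (hu : u ∈ T.subtree x) (hv : v ∈ T.subtree x) (hau : S.Adj a u) (hav : S.Adj a v) : u = v :=
  (h.link x u hu v hv).eq_of_adj hS.isAcyclic ha hau hav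

end IsElimination

/-- Search trees on a tree all of whose subtrees have at most two boundary nodes; these are the
Steiner-closed search trees, see `isSteinerClosedSTT_iff`. -/
structure IsTwoCut (S : SimpleGraph V) (T : RootedTree V) : Prop extends IsElimination S T where
  two : ∀ x, ∀ a ∈ boundary S T x, ∀ b ∈ boundary S T x, ∀ c ∈ boundary S T x,
    a ≠ b → a ≠ c → b ≠ c → False

theorem exists_top_ancestor {A : Set V} (hr : T.root ∈ A) {v : V} (hv : v ∉ A) :
    ∃ y, v ∈ T.subtree y ∧ y ∉ A ∧ y ≠ T.root ∧ T.parent y ∈ A := by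
  induction v using parent_induction (T := T) with
  | hroot => exact absurd hr hv
  | h v hvr ih =>
    by_cases hp : T.parent v ∈ A
    · exact ⟨v, T.self_mem_subtree v, hv, hvr, hp⟩
    · obtain ⟨y, hy, h⟩ := ih hp
      exact ⟨y, mem_subtree_of_parent hy, h⟩

/-- Let `v` be off the search path and `y` an ancestor of `v` (or `v` itself) that is also off it.
No node of the path lies in `T_y`, so every branch at `v` that meets the path contains a boundary
node of `T_y`. Three branches would give three distinct boundary nodes. -/
theorem IsTwoCut.isSteinerClosedSet [Finite V] (hS : S.IsTree) (h : IsTwoCut S T) (x : V) :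
    IsSteinerClosedSet S (T.searchPath x) := by
  rw [isSteinerClosedSet_iff hS]
  intro v hv w₁ w₂ w₃ h₁ h₂ h₃ h12 h13 h23
  obtain ⟨y, hvy, hyA, -, -⟩ := exists_top_ancestor (mem_searchPath.2 (T.mem_subtree_root x)) hv
  have key : ∀ w, Branch S (T.searchPath x) v w → ∃ b ∈ boundary S T y, Link S {v}ᶜ w b := by
    rintro w ⟨hvw, a, ha, hl⟩
    by_cases hw : w ∈ T.subtree y
    · obtain ⟨s, t, hs, hsy, hsv, hty, htv, hst⟩ := hl.exists_exit hw
        (fun hay => hyA (subtree_trans (mem_searchPath.1 ha) hay))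
      exact ⟨t, ⟨hty, s, hsy, hst.symm⟩,
        (hs.mono Set.inter_subset_left).trans (Link.single hst hsv htv)⟩
    · exact ⟨w, ⟨hw, v, hvy, hvw.symm⟩, Link.refl⟩
  have uniq : ∀ u w b, S.Adj v u → S.Adj v w → Link S {v}ᶜ u b → Link S {v}ᶜ w b → u = w :=
    fun u w b hu hw hub hwb => (hub.trans hwb.symm).eq_of_adj hS.isAcyclic (by simp) hu hw
  obtain ⟨b₁, hb₁, l₁⟩ := key w₁ h₁
  obtain ⟨b₂, hb₂, l₂⟩ := key w₂ h₂
  obtain ⟨b₃, hb₃, l₃⟩ := key w₃ h₃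
  refine h.two y b₁ hb₁ b₂ hb₂ b₃ hb₃ ?_ ?_ ?_ <;> rintro rfl
  · exact h12 (uniq _ _ _ h₁.1 h₂.1 l₁ l₂)
  · exact h13 (uniq _ _ _ h₁.1 h₃.1 l₁ l₃)
  · exact h23 (uniq _ _ _ h₂.1 h₃.1 l₂ l₃)

/-- Induction from the leaves. All boundary nodes of `T_y` are on the search path of the parent of
`y`, and each is reached by a branch at `y`. If two of them shared a branch, it would enter the
subtree of one child `d`, and `T_d` would have these two and `y` as boundary nodes. So three
boundary nodes yield three branches at `y`, which is not on that path. -/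
theorem isTwoCut_of_isSteinerClosedSet [Finite V] (hS : S.IsTree) (h : IsElimination S T)
    (hsc : ∀ x, IsSteinerClosedSet S (T.searchPath x)) : IsTwoCut S T := by
  refine ⟨h, fun y => ?_⟩
  induction y using descendant_induction (T := T) with
  | h y ih =>
    intro a ha b hb c hc hab hac hbc
    have hyr : y ≠ T.root := by
      rintro rfl
      rw [boundary_root] at ha
      exact ha
    have hyA : y ∉ T.searchPath (T.parent y) := notMem_searchPath_parent hyr
    have key : ∀ a ∈ boundary S T y, ∃ w, Branch S (T.searchPath (T.parent y)) y w ∧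
        (w = a ∨ ∃ d, T.IsChild d y ∧ w ∈ T.subtree d ∧ a ∈ boundary S T d) := by
      intro a ha
      have hya := h.mem_of_mem_boundary ha
      obtain ⟨hay, a', ha', haa'⟩ := ha
      have haA : a ∈ T.searchPath (T.parent y) :=
        parent_mem_subtree hya (by rintro rfl; exact hay (T.self_mem_subtree _))
      by_cases h1 : a' = y
      · exact ⟨a, ⟨h1 ▸ haa'.symm, a, haA, Link.refl⟩, Or.inl rfl⟩
      · obtain ⟨d, hd, ha'd⟩ := exists_isChild ha' h1
        have hp := h.parent_mem_boundary hd.1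
        rw [hd.2] at hp
        obtain ⟨hyd, w, hw, hyw⟩ := hp
        have hsub : T.subtree d ⊆ {y}ᶜ := fun z hz => by rintro rfl; exact hyd hz
        have hay' : a ≠ y := by rintro rfl; exact hay (T.self_mem_subtree _)
        refine ⟨w, ⟨hyw, a, haA, ((h.link d w hw a' ha'd).mono hsub).trans
          (Link.single haa'.symm (hsub ha'd) hay')⟩, Or.inr ⟨d, hd, hw, ?_⟩⟩
        exact ⟨fun hh => hay (subtree_subset hd.mem_subtree hh), a', ha'd, haa'⟩
    have hne : ∀ a ∈ boundary S T y, ∀ b ∈ boundary S T y, a ≠ b → ∀ u w,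
        (u = a ∨ ∃ d, T.IsChild d y ∧ u ∈ T.subtree d ∧ a ∈ boundary S T d) →
        (w = b ∨ ∃ d, T.IsChild d y ∧ w ∈ T.subtree d ∧ b ∈ boundary S T d) → u ≠ w := by
      intro a ha b hb hab u w hu hw huw
      subst huw
      rcases hu with rfl | ⟨d, hd, hud, had⟩
      · rcases hw with rfl | ⟨e, he, hue, -⟩
        · exact hab rfl
        · exact ha.1 (subtree_subset he.mem_subtree hue)
      · rcases hw with rfl | ⟨e, he, hue, hbe⟩
        · exact hb.1 (subtree_subset hd.mem_subtree hud)
        · obtain rfl := hd.eq_of_mem he hud hue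
          have hp := h.parent_mem_boundary hd.1
          rw [hd.2] at hp
          refine ih d hd a had b hbe y hp hab ?_ ?_
          · rintro rfl; exact ha.1 (T.self_mem_subtree _)
          · rintro rfl; exact hb.1 (T.self_mem_subtree _)
    obtain ⟨w₁, h₁, e₁⟩ := key a ha
    obtain ⟨w₂, h₂, e₂⟩ := key b hb
    obtain ⟨w₃, h₃, e₃⟩ := key c hc
    exact (isSteinerClosedSet_iff hS).1 (hsc _) y hyA w₁ w₂ w₃ h₁ h₂ h₃
      (hne a ha b hb hab _ _ e₁ e₂) (hne a ha c hc hac _ _ e₁ e₃) (hne b hb c hc hbc _ _ e₂ e₃)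

theorem isSteinerClosedSTT_iff [Finite V] (hS : S.IsTree) :
    IsSteinerClosedSTT S T ↔ IsTwoCut S T := by
  rw [IsSteinerClosedSTT, isSTT_iff hS]
  exact ⟨fun h => isTwoCut_of_isSteinerClosedSet hS h.1 h.2,
    fun h => ⟨h.toIsElimination, h.isSteinerClosedSet hS⟩⟩

end STT

/-! ### Rotations and their effect on subtrees and boundaries -/

namespace STT

open STT.RootedTree

variable {V : Type*} {S : SimpleGraph V} {T : RootedTree V} {x : V}

/-- The child `y` of `x` changes its parent in the rotation at `x`. -/
def Moves (S : SimpleGraph V) (T : RootedTree V) (x y : V) : Prop :=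
  T.IsChild y x ∧ ∃ z ∈ T.subtree y, S.Adj (T.parent x) z

open Classical in
/-- The parent map after the rotation at `x`. -/
noncomputable def rotateParent (S : SimpleGraph V) (T : RootedTree V) (x y : V) : V :=
  if y = x then (if T.parent x = T.root then x else T.parent (T.parent x))
  else if y = T.parent x then x
  else if Moves S T x y then T.parent x else T.parent y

open Classical in
/-- The root after the rotation at `x`. -/
noncomputable def rotateRoot (T : RootedTree V) (x : V) : V :=
  if T.parent x = T.root then x else T.root

theorem rotateParent_of_ne {y : V} (h1 : y ≠ x) (h2 : y ≠ T.parent x) (h3 : ¬ Moves S T x y) :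
    rotateParent S T x y = T.parent y := by
  rw [rotateParent, if_neg h1, if_neg h2, if_neg h3]

theorem rotateParent_parent (hx : x ≠ T.root) : rotateParent S T x (T.parent x) = x := by
  rw [rotateParent, if_neg (parent_ne hx), if_pos rfl]

theorem Moves.ne_self {y : V} (h : Moves S T x y) : y ≠ x := h.1.ne

theorem Moves.ne_parent (hx : x ≠ T.root) {y : V} (h : Moves S T x y) : y ≠ T.parent x := by
  rintro rfl
  exact parent_notMem_subtree hx h.1.mem_subtree

theorem rotateParent_moves (hx : x ≠ T.root) {y : V} (h : Moves S T x y) :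
    rotateParent S T x y = T.parent x := by
  rw [rotateParent, if_neg h.ne_self, if_neg (h.ne_parent hx), if_pos h]

/-- The result of the rotation at the non-root node `x`. -/
noncomputable def rotate (S : SimpleGraph V) (T : RootedTree V) (x : V) (hx : x ≠ T.root) :
    RootedTree V where
  root := rotateRoot T x
  parent := rotateParent S T x
  parent_root := by
    by_cases h : T.parent x = T.root
    · simp [rotateRoot, rotateParent, h]
    · have h1 : ¬ Moves S T x T.root := fun hm => hm.1.1 rfl
      rw [rotateRoot, if_neg h, rotateParent_of_ne hx.symm (Ne.symm h) h1, T.parent_root]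
  reaches_root := by
    have step : ∀ y, (∃ k, (rotateParent S T x)^[k] (rotateParent S T x y) = rotateRoot T x) →
        ∃ k, (rotateParent S T x)^[k] y = rotateRoot T x :=
      fun y ⟨k, hk⟩ => ⟨k + 1, by rwa [Function.iterate_succ_apply]⟩
    have hX : (T.parent x ≠ T.root →
        ∃ k, (rotateParent S T x)^[k] (T.parent (T.parent x)) = rotateRoot T x) →
        ∃ k, (rotateParent S T x)^[k] x = rotateRoot T x := by
      intro h
      by_cases hp : T.parent x = T.root
      · exact ⟨0, by simp [rotateRoot, hp]⟩
      · refine step x ?_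
        rw [rotateParent, if_pos rfl, if_neg hp]
        exact h hp
    -- After at most two steps of the new parent map, a node has reached the new root or a proper
    -- ancestor in `T`: the old parent of `x` first goes to `x`, and `x` goes to its old
    -- grandparent.
    intro y
    induction y using ancestor_induction (T := T) with
    | h y ih =>
      by_cases h1 : y = x
      · subst h1
        refine hX fun hp => ih _ (subtree_trans (T.mem_subtree_parent _)
          (T.mem_subtree_parent _)) fun h => parent_notMem_subtree hx ?_
        have := T.mem_subtree_parent (T.parent y)
        rwa [h] at this
      by_cases h2 : y = T.parent x
      · subst h2
        refine step _ ?_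
        rw [rotateParent_parent hx]
        exact hX fun hp => ih _ (T.mem_subtree_parent _) (parent_ne hp)
      by_cases h3 : Moves S T x y
      · refine step _ ?_
        rw [rotateParent_moves hx h3]
        exact ih _ (subtree_trans h3.1.mem_subtree (T.mem_subtree_parent x)) (h3.ne_parent hx).symm
      by_cases h4 : y = T.root
      · subst h4
        exact ⟨0, by rw [rotateRoot, if_neg (Ne.symm h2)]; rfl⟩
      · refine step _ ?_
        rw [rotateParent_of_ne h1 h2 h3]
        exact ih _ (T.mem_subtree_parent y) (parent_ne h4)

/-- The node set of the subtree of the old parent of `x` after the rotation at `x`. -/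
def lowered (S : SimpleGraph V) (T : RootedTree V) (x : V) : Set V :=
  {y | y ∈ T.subtree (T.parent x) ∧ (y ∈ T.subtree x → ∃ c, Moves S T x c ∧ y ∈ T.subtree c)}

theorem notMem_lowered : x ∉ lowered S T x := by
  rintro ⟨-, h⟩
  obtain ⟨c, hc, hxc⟩ := h (T.self_mem_subtree x)
  exact hc.1.notMem_subtree hxc

theorem parent_mem_lowered (hx : x ≠ T.root) : T.parent x ∈ lowered S T x :=
  ⟨T.self_mem_subtree _, fun h => absurd h (parent_notMem_subtree hx)⟩

/-- The subtree map after the rotation at `x` satisfies the recursion of subtrees. -/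
theorem rotate_subtree_aux (hx : x ≠ T.root) (C : V → Set V) (hCx : C x = T.subtree (T.parent x))
    (hCp : C (T.parent x) = lowered S T x)
    (hC : ∀ z, z ≠ x → z ≠ T.parent x → C z = T.subtree z) :
    (∀ z, rotateRoot T x ∈ C z ↔ z = rotateRoot T x) ∧
    ∀ y, y ≠ rotateRoot T x → ∀ z, y ∈ C z ↔ y = z ∨ rotateParent S T x y ∈ C z := by
  have hpx : T.parent x ≠ x := parent_ne hx
  have hxp := T.mem_subtree_parent x
  have hpx' := parent_notMem_subtree hx
  constructor
  · intro z
    by_cases h1 : z = x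
    · subst h1
      rw [hCx, rotateRoot]
      split_ifs with hp
      · simpa using hxp
      · rw [root_mem_subtree]
        exact ⟨fun h => absurd h hp, fun h => absurd h hx⟩
    by_cases h2 : z = T.parent x
    · subst h2
      rw [hCp, rotateRoot]
      split_ifs with hp
      · exact ⟨fun h => absurd h notMem_lowered, fun h => absurd h hpx⟩
      · refine ⟨fun h => root_mem_subtree.1 h.1, fun h => absurd h hp⟩
    rw [hC z h1 h2, rotateRoot]
    split_ifs with hp
    · refine ⟨fun h => ?_, fun h => absurd h h1⟩
      have := parent_mem_subtree h (Ne.symm h1)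
      rw [hp, root_mem_subtree] at this
      exact absurd (this.trans hp.symm) h2
    · exact root_mem_subtree
  · intro y hy z
    by_cases h1 : z = x
    · subst h1
      rw [hCx]
      by_cases g1 : y = z
      · simp [g1, hxp]
      by_cases g2 : y = T.parent z
      · subst g2
        simp [rotateParent_parent hx, hxp, T.self_mem_subtree]
      by_cases g3 : Moves S T z y
      · rw [rotateParent_moves hx g3]
        exact iff_of_true (subtree_trans g3.1.mem_subtree hxp) (Or.inr (T.self_mem_subtree _))
      · rw [rotateParent_of_ne g1 g2 g3, mem_subtree_iff]
        simp [g1, g2]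
    by_cases h2 : z = T.parent x
    · subst h2
      rw [hCp]
      by_cases g1 : y = x
      · subst g1
        have hp : T.parent y ≠ T.root := fun hp => hy (by rw [rotateRoot, if_pos hp])
        rw [rotateParent, if_pos rfl, if_neg hp]
        refine iff_of_false notMem_lowered ?_
        rintro (h | h)
        · exact h1 h.symm
        · exact parent_notMem_subtree hp h.1
      by_cases g2 : y = T.parent x
      · exact iff_of_true (g2 ▸ parent_mem_lowered hx) (Or.inl g2)
      by_cases g3 : Moves S T x y
      · rw [rotateParent_moves hx g3]
        exact iff_of_true ⟨subtree_trans g3.1.mem_subtree hxp, fun _ => ⟨y, g3,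
          T.self_mem_subtree y⟩⟩ (Or.inr (parent_mem_lowered hx))
      · rw [rotateParent_of_ne g1 g2 g3]
        constructor
        · rintro ⟨h, h'⟩
          refine Or.inr ⟨parent_mem_subtree h g2, fun hyx => ?_⟩
          obtain ⟨c, hc, hyc⟩ := h' (mem_subtree_of_parent hyx)
          exact ⟨c, hc, parent_mem_subtree hyc (by rintro rfl; exact g3 hc)⟩
        · rintro (h | ⟨h, h'⟩)
          · exact absurd h g2
          · refine ⟨mem_subtree_of_parent h, fun hyx => ?_⟩
            obtain ⟨c, hc, hyc⟩ := h' (parent_mem_subtree hyx g1)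
            exact ⟨c, hc, mem_subtree_of_parent hyc⟩
    rw [hC z h1 h2]
    by_cases g1 : y = x
    · subst g1
      have hp : T.parent y ≠ T.root := fun hp => hy (by rw [rotateRoot, if_pos hp])
      rw [rotateParent, if_pos rfl, if_neg hp, mem_subtree_iff, mem_subtree_iff (y := T.parent y)]
      simp [Ne.symm h2]
    by_cases g2 : y = T.parent x
    · subst g2
      rw [rotateParent_parent hx, mem_subtree_iff (y := x)]
      simp only [Ne.symm h1, Ne.symm h2, false_or]
    by_cases g3 : Moves S T x y
    · rw [rotateParent_moves hx g3, mem_subtree_iff, g3.1.2, mem_subtree_iff (y := x)]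
      simp [Ne.symm h1]
    · rw [rotateParent_of_ne g1 g2 g3, mem_subtree_iff]

open Classical in
-- Membership in subtrees is determined by its recursion along parents, so any family of sets
-- obeying the recursion of the rotated tree is its family of subtrees.
theorem rotate_subtree (hx : x ≠ T.root) (z : V) :
    (rotate S T x hx).subtree z = if z = x then T.subtree (T.parent x)
      else if z = T.parent x then lowered S T x else T.subtree z := by
  set C : V → Set V := fun z => if z = x then T.subtree (T.parent x)
      else if z = T.parent x then lowered S T x else T.subtree z with hC
  obtain ⟨hr, hp⟩ := rotate_subtree_aux (S := S) hx C (by simp [hC])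
    (by simp [hC, parent_ne hx]) (fun z h1 h2 => by simp [hC, h1, h2])
  change _ = C z
  ext y
  induction y using parent_induction (T := rotate S T x hx) with
  | hroot => rw [root_mem_subtree]; exact (hr z).symm
  | h y hy ih => rw [mem_subtree_iff, ih]; exact (hp y hy z).symm

theorem rotate_subtree_self (hx : x ≠ T.root) :
    (rotate S T x hx).subtree x = T.subtree (T.parent x) := by
  rw [rotate_subtree, if_pos rfl]

theorem rotate_subtree_parent (hx : x ≠ T.root) :
    (rotate S T x hx).subtree (T.parent x) = lowered S T x := by
  rw [rotate_subtree, if_neg (parent_ne hx), if_pos rfl]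

theorem rotate_subtree_of_ne (hx : x ≠ T.root) {z : V} (h1 : z ≠ x) (h2 : z ≠ T.parent x) :
    (rotate S T x hx).subtree z = T.subtree z := by
  rw [rotate_subtree, if_neg h1, if_neg h2]

theorem rotate_boundary_self (hx : x ≠ T.root) :
    boundary S (rotate S T x hx) x = boundary S T (T.parent x) := by
  rw [boundary, boundary, rotate_subtree_self]

theorem rotate_boundary_of_ne (hx : x ≠ T.root) {z : V} (h1 : z ≠ x) (h2 : z ≠ T.parent x) :
    boundary S (rotate S T x hx) z = boundary S T z := by
  rw [boundary, boundary, rotate_subtree_of_ne hx h1 h2]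

/-- A node of the subtree of `x` that stays below the old parent of `x` after the rotation loses
exactly that ancestor. -/
theorem rotate_searchPath (hx : x ≠ T.root) {v : V} (hv : v ∈ T.subtree x)
    (hv' : v ∉ lowered S T x) :
    T.searchPath v = insert (T.parent x) ((rotate S T x hx).searchPath v) := by
  ext z
  simp only [Set.mem_insert_iff, mem_searchPath]
  by_cases h1 : z = x
  · subst h1
    rw [rotate_subtree_self]
    exact iff_of_true hv (Or.inr (subtree_trans hv (T.mem_subtree_parent _)))
  by_cases h2 : z = T.parent x
  · exact iff_of_true (h2 ▸ subtree_trans hv (T.mem_subtree_parent _)) (Or.inl h2)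
  rw [rotate_subtree_of_ne hx h1 h2]
  simp [h2]

theorem ncard_rotate_searchPath [Finite V] (hx : x ≠ T.root) {v : V} (hv : v ∈ T.subtree x)
    (hv' : v ∉ lowered S T x) :
    (T.searchPath v).ncard = ((rotate S T x hx).searchPath v).ncard + 1 := by
  rw [rotate_searchPath hx hv hv', Set.ncard_insert_of_notMem]
  rw [mem_searchPath, rotate_subtree_parent]
  exact hv'

theorem isRotation_rotate (hx : x ≠ T.root) : IsRotation S T x (rotate S T x hx) where
  ne_root := hx
  parent_old := rotateParent_parent hx
  place_root h := if_pos h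
  place_inner h := ⟨if_neg h, by
    change rotateParent S T x x = _
    rw [rotateParent, if_pos rfl, if_neg h]⟩
  moved _ h h' := rotateParent_moves hx ⟨h, h'⟩
  kept _ h1 h2 h3 := rotateParent_of_ne h1 h2 h3

theorem eq_or_moves {u : V} (hu : u ∈ T.subtree x)
    (ha : S.Adj (T.parent x) u) : u = x ∨ ∃ c, Moves S T x c ∧ u ∈ T.subtree c := by
  by_cases hux : u = x
  · exact Or.inl hux
  · obtain ⟨c, hc, huc⟩ := exists_isChild hu hux
    exact Or.inr ⟨c, ⟨hc, u, huc, ha⟩, huc⟩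

namespace IsElimination

theorem moves_adj (h : IsElimination S T) {c : V} (hc : Moves S T x c) :
    ∃ z ∈ T.subtree c, S.Adj x z := by
  have hb := h.parent_mem_boundary hc.1.1
  rw [hc.1.2] at hb
  exact hb.2

/-- The reverse rotation moves back the right children. A moved child was a child of `x`, so its
subtree is adjacent to `x`; any other child of the old parent is incomparable to `x` in `T`, so its
subtree has no edge to `x`. -/
theorem isRotation_rotate_symm (h : IsElimination S T) (hx : x ≠ T.root) :
    IsRotation S (rotate S T x hx) (T.parent x) T := by
  have hpp : (rotate S T x hx).parent (T.parent x) = x := rotateParent_parent hx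
  have hroot : (rotate S T x hx).root = x ↔ T.parent x = T.root := by
    change rotateRoot T x = x ↔ _
    rw [rotateRoot]
    split_ifs with hp
    · simp [hp]
    · exact iff_of_false (Ne.symm hx) hp
  refine ⟨?_, ?_, ?_, ?_, ?_, ?_⟩
  · change T.parent x ≠ rotateRoot T x
    rw [rotateRoot]
    split_ifs with hp
    · exact parent_ne hx
    · exact hp
  · rw [hpp]
  · rw [hpp]
    intro hr
    exact (hroot.1 hr.symm).symm
  · rw [hpp]
    intro hr
    have hp : T.parent x ≠ T.root := fun hp => hr (hroot.2 hp).symm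
    obtain ⟨h1, h2⟩ := (isRotation_rotate (S := S) hx).place_inner hp
    exact ⟨h1.symm, h2.symm⟩
  · rw [hpp]
    rintro y ⟨hyr, hyp⟩ ⟨z, hz, hxz⟩
    change rotateParent S T x y = T.parent x at hyp
    by_cases h1 : y = x
    · subst h1
      by_cases hp : T.parent y = T.root
      · exact absurd (hroot.2 hp).symm hyr
      · rw [rotateParent, if_pos rfl, if_neg hp] at hyp
        exact absurd hyp (parent_ne hp)
    by_cases h2 : y = T.parent x
    · subst h2
      rw [rotateParent_parent hx] at hyp
      exact absurd hyp.symm (parent_ne hx)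
    rw [rotate_subtree_of_ne hx h1 h2] at hz
    by_cases h3 : Moves S T x y
    · exact h3.1.2
    · rw [rotateParent_of_ne h1 h2 h3] at hyp
      exfalso
      have hyr' : y ≠ T.root := by
        rintro rfl
        rw [T.parent_root] at hyp
        exact h2 hyp
      have hc : T.IsChild y (T.parent x) := ⟨hyr', hyp⟩
      have hc' : T.IsChild x (T.parent x) := isChild_parent hx
      rcases h.comparable x z hxz with h4 | h4
      · exact h1 (hc.eq_of_mem hc' (subtree_trans h4 hz) (T.self_mem_subtree x))
      · exact h1 (hc.eq_of_mem hc' hz h4)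
  · rw [hpp]
    intro y h2 h1 h3
    change _ = rotateParent S T x y
    by_cases hm : Moves S T x y
    · exfalso
      refine h3 ⟨⟨?_, rotateParent_moves hx hm⟩, ?_⟩
      · rintro hyr
        have := hm.1.1
        change y = rotateRoot T x at hyr
        rw [rotateRoot] at hyr
        split_ifs at hyr
        · exact h1 hyr
        · exact this hyr
      · rw [rotate_subtree_of_ne hx h1 h2]
        exact h.moves_adj hm
    · rw [rotateParent_of_ne h1 h2 hm]

theorem rotate (h : IsElimination S T) (hx : x ≠ T.root) :
    IsElimination S (rotate S T x hx) := by
  have hxp := T.mem_subtree_parent x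
  constructor
  -- Only edges from the old parent into `T_x` are at stake. They end at `x` or in the subtree of a
  -- child that moves, which is why these children move.
  · have key : ∀ u v, S.Adj u v → u ∈ T.subtree v →
        u ∈ (STT.rotate S T x hx).subtree v ∨ v ∈ (STT.rotate S T x hx).subtree u := by
      intro u v huv hu
      by_cases h1 : v = x
      · subst h1
        rw [rotate_subtree_self]
        exact Or.inl (subtree_trans hu hxp)
      by_cases h2 : v = T.parent x
      · subst h2
        rw [rotate_subtree_parent]
        by_cases hux : u ∈ T.subtree x
        · rcases eq_or_moves hux huv.symm with rfl | hm
          · rw [rotate_subtree_self]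
            exact Or.inr (T.self_mem_subtree _)
          · exact Or.inl ⟨hu, fun _ => hm⟩
        · exact Or.inl ⟨hu, fun h => absurd h hux⟩
      rw [rotate_subtree_of_ne hx h1 h2]
      exact Or.inl hu
    intro u v huv
    rcases h.comparable u v huv with h1 | h1
    · exact key u v huv h1
    · exact (key v u huv.symm h1).symm
  · intro z
    by_cases h1 : z = x
    · subst h1
      rw [rotate_subtree_self]
      exact h.link _
    by_cases h2 : z = T.parent x
    · subst h2
      rw [rotate_subtree_parent]
      have hpD := parent_mem_lowered (S := S) hx
      -- The new subtree of the old parent consists of that node and subtrees `T_c`, each connected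
      -- and adjacent to it.
      have key : ∀ u ∈ lowered S T x, Link S (lowered S T x) u (T.parent x) := by
        intro u hu
        by_cases hup : u = T.parent x
        · rw [hup]
          exact Link.refl
        have hpart : ∃ c, u ∈ T.subtree c ∧ T.subtree c ⊆ lowered S T x ∧
            ∃ z ∈ T.subtree c, S.Adj (T.parent x) z := by
          by_cases hux : u ∈ T.subtree x
          · obtain ⟨c, hc, huc⟩ := hu.2 hux
            exact ⟨c, huc, fun w hw => ⟨subtree_trans hw (subtree_trans hc.1.mem_subtree hxp),
              fun _ => ⟨c, hc, hw⟩⟩, hc.2⟩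
          · obtain ⟨c, hc, huc⟩ := exists_isChild hu.1 hup
            refine ⟨c, huc, fun w hw => ⟨subtree_trans hw hc.mem_subtree, fun hwx => ?_⟩, ?_⟩
            · obtain rfl := hc.eq_of_mem (isChild_parent hx) hw hwx
              exact absurd huc hux
            · have hb := h.parent_mem_boundary hc.1
              rw [hc.2] at hb
              exact hb.2
        obtain ⟨c, huc, hcD, w, hw, hpw⟩ := hpart
        exact ((h.link c u huc w hw).mono hcD).trans (Link.single hpw.symm (hcD hw) hpD)
      exact fun u hu v hv => (key u hu).trans (key v hv).symm
    rw [rotate_subtree_of_ne hx h1 h2]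
    exact h.link z

theorem rotate_boundary_parent (h : IsElimination S T) (hx : x ≠ T.root) {a : V}
    (ha : a ∈ boundary S (STT.rotate S T x hx) (T.parent x)) :
    a = x ∨ a ∈ boundary S T (T.parent x) := by
  have hc : (STT.rotate S T x hx).IsChild (T.parent x) x :=
    ⟨(h.isRotation_rotate_symm hx).ne_root, rotateParent_parent hx⟩
  have := (h.rotate hx).eq_or_mem_boundary hc ha
  rwa [rotate_boundary_self] at this

end IsElimination

namespace IsTwoCut

/-- If `x` has a boundary node `a` besides its parent, then `a` is not a boundary node of the old
parent of `x` after the rotation at `x`. -/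
theorem notMem_rotate_boundary (hS : S.IsTree) (h : IsTwoCut S T) (hx : x ≠ T.root) {a : V}
    (ha : a ∈ boundary S T x) (hap : a ≠ T.parent x) :
    a ∈ boundary S T (T.parent x) ∧
      a ∉ boundary S (rotate S T x hx) (T.parent x) := by
  have hap' := (h.eq_or_mem_boundary (isChild_parent hx) ha).resolve_left hap
  refine ⟨hap', ?_⟩
  rintro ⟨-, w, hw, haw⟩
  rw [rotate_subtree_parent] at hw
  obtain ⟨hax, w', hw', haw'⟩ := ha
  -- The node `a` has only one neighbour in the connected subtree of the parent, and it lies in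
  -- `T_x`. Were it lowered, it would lie in `T_c` for a moved child `c`, whose boundary would
  -- contain `a`, `x` and the parent of `x`.
  obtain rfl := h.eq_of_adj hS hap'.1 hw.1 (subtree_trans hw' (T.mem_subtree_parent x)) haw haw'
  obtain ⟨c, hc, hwc⟩ := hw.2 hw'
  refine h.two c a ⟨fun hac => hax (subtree_subset hc.1.mem_subtree hac), w, hwc, haw⟩
    x ⟨hc.1.notMem_subtree, h.moves_adj hc⟩ (T.parent x)
    ⟨fun hpc => parent_notMem_subtree hx (subtree_subset hc.1.mem_subtree hpc), hc.2⟩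
    ?_ hap (parent_ne hx).symm
  rintro rfl
  exact hax (T.self_mem_subtree _)

theorem exists_of_not_subsingleton {B : Set V} (hB : ¬ B.Subsingleton) (p : V) :
    ∃ a ∈ B, a ≠ p := by
  by_contra hcon
  push Not at hcon
  exact hB fun a ha b hb => (hcon a ha).trans (hcon b hb).symm

/-- Only the boundary of the old parent needs an argument: besides `x`, it may keep just one old
boundary node. Either there was at most one, or `x` is wide and its second boundary node gets lost
from at most two. -/
theorem rotate (hS : S.IsTree) (h : IsTwoCut S T) (hx : x ≠ T.root)
    (hc : (boundary S T (T.parent x)).Subsingleton ∨ ¬ (boundary S T x).Subsingleton) :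
    IsTwoCut S (rotate S T x hx) := by
  refine ⟨h.toIsElimination.rotate hx, fun z => ?_⟩
  by_cases h1 : z = x
  · subst h1
    rw [rotate_boundary_self]
    exact h.two _
  by_cases h2 : z = T.parent x
  · subst h2
    have key : ∀ a ∈ boundary S (STT.rotate S T x hx) (T.parent x),
        ∀ b ∈ boundary S (STT.rotate S T x hx) (T.parent x), a ≠ x → b ≠ x → a = b := by
      intro a ha b hb hax hbx
      have ha' := (h.rotate_boundary_parent hx ha).resolve_left hax
      have hb' := (h.rotate_boundary_parent hx hb).resolve_left hbx
      rcases hc with hc | hc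
      · exact hc ha' hb'
      · obtain ⟨d, hd, hdp⟩ := exists_of_not_subsingleton hc (T.parent x)
        obtain ⟨hd1, hd2⟩ := h.notMem_rotate_boundary hS hx hd hdp
        by_contra hab
        refine h.two _ a ha' b hb' d hd1 hab ?_ ?_
        · rintro rfl; exact hd2 ha
        · rintro rfl; exact hd2 hb
    intro a ha b hb c hc' hab hac hbc
    by_cases hax : a = x
    · exact hbc (key b hb c hc' (fun h => hab (hax.trans h.symm)) fun h => hac (hax.trans h.symm))
    by_cases hbx : b = x
    · exact hac (key a ha c hc' hax fun h => hbc (hbx.trans h.symm))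
    exact hab (key a ha b hb hax hbx)
  rw [rotate_boundary_of_ne hx h1 h2]
  exact h.two z

/-- Rotating a node with two boundary nodes above a node with one yields two nodes with one. -/
theorem rotate_boundary_subsingleton (hS : S.IsTree) (h : IsTwoCut S T) (hx : x ≠ T.root)
    (hp : (boundary S T (T.parent x)).Subsingleton) (hc : ¬ (boundary S T x).Subsingleton) :
    (boundary S (STT.rotate S T x hx) (T.parent x)).Subsingleton := by
  obtain ⟨d, hd, hdp⟩ := exists_of_not_subsingleton hc (T.parent x)
  obtain ⟨hd1, hd2⟩ := h.notMem_rotate_boundary hS hx hd hdp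
  have key : ∀ a ∈ boundary S (STT.rotate S T x hx) (T.parent x), a = x := by
    intro a ha
    rcases h.rotate_boundary_parent hx ha with h1 | h1
    · exact h1
    · exact absurd (hp h1 hd1 ▸ ha) hd2
  exact fun a ha b hb => (key a ha).trans (key b hb).symm

end IsTwoCut

end STT

/-! ### Sequences of pointer moves and rotations -/

namespace STT

open STT.RootedTree

variable {V : Type*} {S : SimpleGraph V}

/-- `Trek S s t m k`: the pointer model leads from `s` to `t` in `m` steps, `k` of which are
rotations, through two-cut search trees. -/
inductive Trek (S : SimpleGraph V) (s : RootedTree V × V) : RootedTree V × V → ℕ → ℕ → Prop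
  | refl (h : IsTwoCut S s.1) : Trek S s s 0 0
  | up {T : RootedTree V} {x : V} {m k : ℕ} (h : Trek S s (T, x) m k) (hx : x ≠ T.root) :
      Trek S s (T, T.parent x) (m + 1) k
  | down {T : RootedTree V} {x y : V} {m k : ℕ} (h : Trek S s (T, x) m k) (hy : T.IsChild y x) :
      Trek S s (T, y) (m + 1) k
  | rotate {T T' : RootedTree V} {x : V} {m k : ℕ} (h : Trek S s (T, x) m k)
      (hr : IsRotation S T x T') (hr' : IsRotation S T' (T.parent x) T) (h' : IsTwoCut S T') :
      Trek S s (T', x) (m + 1) (k + 1)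

namespace Trek

variable {s t u : RootedTree V × V} {m k m' k' : ℕ}

theorem trans (h : Trek S s t m k) (h' : Trek S t u m' k') : Trek S s u (m + m') (k + k') := by
  induction h' with
  | refl _ => exact h
  | up _ hx ih => exact ih.up hx
  | down _ hy ih => exact ih.down hy
  | rotate _ hr hr' hT ih => exact ih.rotate hr hr' hT

theorem isTwoCut (h : Trek S s t m k) : IsTwoCut S t.1 := by
  induction h with
  | refl h => exact h
  | up _ _ ih => exact ih
  | down _ _ ih => exact ih
  | rotate _ _ _ h _ => exact h

/-- Undoing a rotation at `x` takes three steps: down to the old parent, the inverse rotation there,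
and down again to `x`. This is the factor 3; the number of rotations stays the same. -/
theorem reverse (h : Trek S s t m k) : ∃ m' ≤ 3 * m, Trek S t s m' k := by
  induction h with
  | refl h => exact ⟨0, le_rfl, refl h⟩
  | @up T x m k h hx ih =>
    obtain ⟨m', hm', ih⟩ := ih
    have h1 : Trek S (T, T.parent x) (T, x) 1 0 :=
      down (refl h.isTwoCut) (isChild_parent hx)
    exact ⟨1 + m', by omega, by simpa using h1.trans ih⟩
  | @down T x y m k h hy ih =>
    obtain ⟨m', hm', ih⟩ := ih
    have h1 : Trek S (T, y) (T, T.parent y) 1 0 := up (refl h.isTwoCut) hy.1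
    rw [hy.2] at h1
    exact ⟨1 + m', by omega, by simpa using h1.trans ih⟩
  | @rotate T T' x m k h hr hr' hT ih =>
    obtain ⟨m', hm', ih⟩ := ih
    have h1 : Trek S (T', x) (T', T.parent x) 1 0 :=
      (refl hT).down ⟨hr'.ne_root, hr.parent_old⟩
    have h2 : Trek S (T', x) (T, T.parent x) 2 1 :=
      h1.rotate hr' (by rw [hr.parent_old]; exact hr) h.isTwoCut
    have h3 : Trek S (T', x) (T, x) 3 1 := h2.down (isChild_parent hr.ne_root)
    refine ⟨3 + m', by omega, ?_⟩
    rw [add_comm k 1]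
    exact h3.trans ih

theorem exists_extend {α : Type*} {r : α → α → Prop} {P : α → Prop} {a b c : α} {m : ℕ}
    (h : ∃ R : ℕ → α, R 0 = a ∧ R m = b ∧ (∀ i < m, r (R i) (R (i + 1))) ∧ ∀ i ≤ m, P (R i))
    (hbc : r b c) (hc : P c) :
    ∃ R : ℕ → α, R 0 = a ∧ R (m + 1) = c ∧ (∀ i < m + 1, r (R i) (R (i + 1))) ∧
      ∀ i ≤ m + 1, P (R i) := by
  obtain ⟨R, h0, hm, hr, hP⟩ := h
  refine ⟨fun i => if i ≤ m then R i else c, by simpa using h0, by simp, fun i hi => ?_,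
    fun i hi => ?_⟩
  · rcases Nat.lt_succ_iff_lt_or_eq.1 hi with h | rfl
    · simpa [h.le, Nat.succ_le_iff.2 h] using hr i h
    · simpa [hm] using hbc
  · by_cases h : i ≤ m
    · simpa [h] using hP i h
    · simpa [h] using hc

theorem exists_rotations [Finite V] (hS : S.IsTree) (h : Trek S s t m k) :
    ∃ R : ℕ → RootedTree V, R 0 = s.1 ∧ R k = t.1 ∧
      (∀ i < k, ∃ x, IsRotation S (R i) x (R (i + 1))) ∧
      ∀ i ≤ k, IsSteinerClosedSTT S (R i) := by
  induction h with
  | refl h =>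
    exact ⟨fun _ => s.1, rfl, rfl, fun i hi => absurd hi (Nat.not_lt_zero i),
      fun _ _ => (isSteinerClosedSTT_iff hS).2 h⟩
  | up _ _ ih => exact ih
  | down _ _ ih => exact ih
  | @rotate T T' x m k _ hr _ hT ih =>
    exact exists_extend (r := fun T T' => ∃ x, IsRotation S T x T')
      (P := IsSteinerClosedSTT S) ih ⟨x, hr⟩ ((isSteinerClosedSTT_iff hS).2 hT)

theorem exists_pointerSteps [Finite V] (hS : S.IsTree) (h : Trek S s t m k) :
    ∃ R : ℕ → RootedTree V × V, R 0 = s ∧ R m = t ∧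
      (∀ i < m, PointerStep S (R i) (R (i + 1))) ∧
      ∀ i ≤ m, IsSteinerClosedSTT S (R i).1 := by
  induction h with
  | refl h =>
    exact ⟨fun _ => s, rfl, rfl, fun i hi => absurd hi (Nat.not_lt_zero i),
      fun _ _ => (isSteinerClosedSTT_iff hS).2 h⟩
  | up h hx ih =>
    exact exists_extend (P := fun s : RootedTree V × V => IsSteinerClosedSTT S s.1) ih
      (PointerStep.up _ _ hx)
      ((isSteinerClosedSTT_iff hS).2 h.isTwoCut)
  | down h hy ih =>
    exact exists_extend (P := fun s : RootedTree V × V => IsSteinerClosedSTT S s.1) ih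
      (PointerStep.down _ _ _ hy)
      ((isSteinerClosedSTT_iff hS).2 h.isTwoCut)
  | rotate _ hr _ hT ih =>
    exact exists_extend (P := fun s : RootedTree V × V => IsSteinerClosedSTT S s.1) ih
      (PointerStep.rotate _ _ _ hr)
      ((isSteinerClosedSTT_iff hS).2 hT)

theorem of_rotate (hS : S.IsTree) {T : RootedTree V} (h : IsTwoCut S T) {x : V}
    (hx : x ≠ T.root)
    (hc : (boundary S T (T.parent x)).Subsingleton ∨ ¬ (boundary S T x).Subsingleton) :
    Trek S (T, x) (STT.rotate S T x hx, x) 1 1 :=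
  Trek.rotate (Trek.refl h) (isRotation_rotate hx) (h.isRotation_rotate_symm hx) (h.rotate hS hx hc)

end Trek

theorem trek_from_root [Finite V] {T : RootedTree V} (h : IsTwoCut S T) (x : V) :
    ∃ m, Trek S (T, T.root) (T, x) m 0 ∧ m ≤ (T.searchPath x).ncard := by
  induction x using parent_induction (T := T) with
  | hroot => exact ⟨0, Trek.refl h, Nat.zero_le _⟩
  | h x hx ih =>
    obtain ⟨m, hm, hle⟩ := ih
    exact ⟨m + 1, hm.down (isChild_parent hx), by rw [ncard_searchPath hx]; omega⟩

/-- Any node can be made the root by as many rotations as it has proper ancestors. -/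
theorem exists_trek_to_root [Finite V] (hS : S.IsTree) (r : V) (d : ℕ) :
    ∀ T : RootedTree V, IsTwoCut S T → (T.searchPath r).ncard = d + 1 →
      ∃ T' : RootedTree V, T'.root = r ∧ ∃ m ≤ 3 * d, Trek S (T, r) (T', r) m d := by
  induction d with
  | zero =>
    intro T hT hd
    refine ⟨T, ?_, 0, le_rfl, Trek.refl hT⟩
    obtain ⟨a, ha⟩ := Set.ncard_eq_one.1 hd
    have h1 : T.root ∈ T.searchPath r := mem_searchPath.2 (T.mem_subtree_root r)
    have h2 : r ∈ T.searchPath r := T.self_mem_subtree r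
    rw [ha] at h1 h2
    exact Eq.trans h1 h2.symm
  | succ d ih =>
    intro T hT hd
    have hr : r ≠ T.root := by
      rintro rfl
      rw [searchPath_root, Set.ncard_singleton] at hd
      omega
    by_cases hc : (boundary S T (T.parent r)).Subsingleton ∨ ¬ (boundary S T r).Subsingleton
    · have hrot := Trek.of_rotate hS hT hr hc
      have hn := ncard_rotate_searchPath (S := S) hr (T.self_mem_subtree r) notMem_lowered
      obtain ⟨T', hT', m, hm, ht⟩ := ih _ hrot.isTwoCut (Nat.succ.inj (hn.symm.trans hd))
      refine ⟨T', hT', 1 + m, by omega, ?_⟩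
      rw [add_comm d 1]
      exact hrot.trans ht
    -- Now the parent is wide and `r` is narrow. Rotating at the parent is allowed, and it also
    -- removes one ancestor of `r`.
    · push Not at hc
      obtain ⟨hp, hrs⟩ := hc
      have hpr : T.parent r ≠ T.root := by
        intro h
        rw [h, boundary_root] at hp
        exact Set.not_subsingleton_iff.2 hp Set.subsingleton_empty
      have hrot := Trek.of_rotate hS hT hpr (Or.inr (Set.not_subsingleton_iff.2 hp))
      -- The only boundary node of `r` is its parent, so the grandparent is not adjacent to the
      -- subtree of `r` and `r` does not move.
      have hrl : r ∉ lowered S T (T.parent r) := by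
        rintro ⟨-, h⟩
        obtain ⟨c, hc, hrc⟩ := h (T.mem_subtree_parent r)
        obtain rfl := hc.1.eq_of_mem (isChild_parent hr) hrc (T.self_mem_subtree r)
        refine parent_ne hpr (hrs ⟨fun h => ?_, hc.2⟩ (hT.parent_mem_boundary hr))
        exact parent_notMem_subtree hpr (subtree_trans h (T.mem_subtree_parent c))
      have hn := ncard_rotate_searchPath (S := S) hpr (T.mem_subtree_parent r) hrl
      obtain ⟨T', hT', m, hm, ht⟩ := ih _ hrot.isTwoCut (Nat.succ.inj (hn.symm.trans hd))
      have h1 : Trek S (T, r) (T, T.parent r) 1 0 := (Trek.refl hT).up hr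
      have h2 := h1.trans hrot
      have hchild : (rotate S T (T.parent r) hpr).IsChild r (T.parent r) := by
        have h3 : ¬ Moves S T (T.parent r) r := fun hm =>
          hrl ⟨subtree_trans (T.mem_subtree_parent r) (T.mem_subtree_parent _),
            fun _ => ⟨r, hm, T.self_mem_subtree r⟩⟩
        have h4 : r ≠ T.parent (T.parent r) := by
          intro h
          refine parent_notMem_subtree hpr ?_
          rw [← h]
          exact T.mem_subtree_parent r
        refine ⟨?_, rotateParent_of_ne (parent_ne hr).symm h4 h3⟩
        change r ≠ rotateRoot T (T.parent r)
        rw [rotateRoot]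
        split_ifs
        · exact (parent_ne hr).symm
        · exact hr
      have h5 := (h2.down hchild).trans ht
      refine ⟨T', hT', 1 + 1 + 1 + m, by omega, ?_⟩
      rw [add_comm d 1]
      simpa using h5

/-! ### Removing wide nodes -/

/-- The nodes whose subtrees have more than one boundary node. -/
def wide (S : SimpleGraph V) (T : RootedTree V) : Set V :=
  {x | ¬ (boundary S T x).Subsingleton}

/-- The tour that removes all wide nodes. The pointer is at `x`, and `D` is the set of nodes that
the tour has left for good. -/
theorem exists_trek_narrow [Finite V] (hS : S.IsTree) (r : V) (N : ℕ) :
    ∀ (T : RootedTree V) (x : V) (D : Set V), IsTwoCut S T → T.root = r →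
      (∀ a, x ∈ T.subtree a → (boundary S T a).Subsingleton) →
      (∀ y ∈ D, (boundary S T y).Subsingleton) → (∀ y ∈ D, T.subtree y ⊆ D) → x ∉ D →
      2 * (wide S T).ncard + 2 * Dᶜ.ncard ≤ N + (T.searchPath x).ncard →
      ∃ (T' : RootedTree V) (m k : ℕ), T'.root = r ∧
        (∀ a, (boundary S T' a).Subsingleton) ∧ Trek S (T, x) (T', r) m k ∧ m ≤ N ∧
        k ≤ (wide S T).ncard := by
  induction N using Nat.strong_induction_on with
  | h N ih =>
    intro T x D hT hroot hanc hDs hD hx hN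
    -- The budget `N` bounds twice the number of wide nodes plus twice the number of unfinished
    -- nodes minus the length of the search path. No ancestor of `x` is finished, so `N` is large
    -- enough for the subtractions below not to truncate.
    have hpath : (T.searchPath x).ncard ≤ Dᶜ.ncard :=
      Set.ncard_le_ncard (fun a ha haD => hx (hD a haD ha)) (Set.toFinite _)
    have hpos : 0 < Dᶜ.ncard := (Set.ncard_pos (Set.toFinite _)).2 ⟨x, hx⟩
    -- A wide child `y` is visited and rotated: two steps, one wide node fewer. The search path of
    -- the pointer keeps its length, as `y` takes the place of `x`.
    by_cases h1 : ∃ y, T.IsChild y x ∧ y ∈ wide S T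
    · obtain ⟨y, hy, hyw⟩ := h1
      obtain ⟨hyr, rfl⟩ := hy
      have hp := hanc _ (T.self_mem_subtree _)
      have hrot := Trek.of_rotate hS hT hyr (Or.inl hp)
      have hps := hT.rotate_boundary_subsingleton hS hyr hp hyw
      have hyD : y ∉ D := fun h => hyw (hDs y h)
      -- Children of the root are narrow, so the rotation keeps the root.
      have hpr : T.parent y ≠ T.root := by
        intro h
        refine hyw ?_
        have key : ∀ a ∈ boundary S T y, a = T.parent y := fun a ha =>
          (hT.eq_or_mem_boundary (isChild_parent hyr) ha).resolve_right (by
            rw [h, boundary_root]; exact Set.notMem_empty a)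
        exact fun a ha b hb => (key a ha).trans (key b hb).symm
      have hwide : wide S (rotate S T y hyr) = wide S T \ {y} := by
        ext z
        simp only [wide, Set.mem_sdiff, Set.mem_singleton_iff, Set.mem_ofPred_eq]
        by_cases g1 : z = y
        · subst g1
          rw [rotate_boundary_self]
          simp [hp]
        by_cases g2 : z = T.parent y
        · subst g2
          simp [hps, hp]
        rw [rotate_boundary_of_ne hyr g1 g2]
        simp [g1]
      have hcard : (wide S T).ncard = (wide S (rotate S T y hyr)).ncard + 1 := by
        rw [hwide, Set.ncard_sdiff_singleton_add_one hyw (Set.toFinite _)]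
      have hsp := ncard_rotate_searchPath (S := S) hyr (T.self_mem_subtree y) notMem_lowered
      have hsp' := ncard_searchPath hyr
      have hDne : ∀ z ∈ D, z ≠ y ∧ z ≠ T.parent y := fun z hz =>
        ⟨by rintro rfl; exact hyD hz, by rintro rfl; exact hx hz⟩
      obtain ⟨T', m, k, hr, hs, ht, hm, hk⟩ := ih (N - 2) (by omega) (rotate S T y hyr) y D
        hrot.isTwoCut ((if_neg hpr).trans hroot)
        (by
          intro a ha
          by_cases g1 : a = y
          · subst g1
            rwa [rotate_boundary_self]
          by_cases g2 : a = T.parent y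
          · rwa [g2]
          rw [rotate_subtree_of_ne hyr g1 g2] at ha
          rw [rotate_boundary_of_ne hyr g1 g2]
          exact hanc a (parent_mem_subtree ha (Ne.symm g1)))
        (fun z hz => by
          rw [rotate_boundary_of_ne hyr (hDne z hz).1 (hDne z hz).2]; exact hDs z hz)
        (fun z hz => by
          rw [rotate_subtree_of_ne hyr (hDne z hz).1 (hDne z hz).2]; exact hD z hz)
        hyD (by omega)
      have h3 := (((Trek.refl hT).down (isChild_parent hyr)).trans hrot).trans ht
      exact ⟨T', _, _, hr, hs, h3, by omega, by omega⟩
    by_cases h2 : ∃ y, T.IsChild y x ∧ y ∉ D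
    · obtain ⟨y, hy, hyD⟩ := h2
      have hyn : (boundary S T y).Subsingleton := by
        by_contra h
        exact h1 ⟨y, hy, h⟩
      have hsp := ncard_searchPath hy.1
      rw [hy.2] at hsp
      obtain ⟨T', m, k, hr, hs, ht, hm, hk⟩ := ih (N - 1) (by omega) T y D hT hroot
        (by
          intro a ha
          by_cases g : y = a
          · rwa [← g]
          · exact hanc a (hy.mem_of_ancestor ha g))
        hDs hD hyD (by omega)
      have h3 := ((Trek.refl hT).down hy).trans ht
      exact ⟨T', _, _, hr, hs, h3, by omega, by omega⟩
    -- All children of `x` are finished, so `x` is finished too. Moving up shortens the path by one,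
    -- while the smaller unfinished set releases two units.
    push Not at h2
    have hsub : T.subtree x ⊆ insert x D := by
      intro z hz
      by_cases hzx : z = x
      · exact Or.inl hzx
      · obtain ⟨c, hc, hzc⟩ := exists_isChild hz hzx
        exact Or.inr (hD c (h2 c hc) hzc)
    have hDs' : ∀ y ∈ insert x D, (boundary S T y).Subsingleton := by
      rintro y (rfl | hy)
      · exact hanc y (T.self_mem_subtree y)
      · exact hDs y hy
    by_cases hxr : x = T.root
    · refine ⟨T, 0, 0, hroot, fun a => hDs' a (hsub ?_), ?_, Nat.zero_le _, Nat.zero_le _⟩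
      rotate_left
      · rw [← hroot, ← hxr]
        exact Trek.refl hT
      rw [hxr]
      exact T.mem_subtree_root a
    · have hc : Dᶜ.ncard = (insert x D)ᶜ.ncard + 1 := by
        rw [← Set.ncard_sdiff_singleton_add_one (s := Dᶜ) hx (Set.toFinite _)]
        congr 2
        ext z
        simp [and_comm]
      have hsp := ncard_searchPath hxr
      obtain ⟨T', m, k, hr, hs, ht, hm, hk⟩ := ih (N - 1) (by omega) T (T.parent x)
        (insert x D) hT hroot
        (fun a ha => hanc a (mem_subtree_of_parent ha)) hDs'
        (by
          rintro y (rfl | hy)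
          · exact hsub
          · exact (hD y hy).trans (Set.subset_insert x D))
        (by
          rintro (h | h)
          · exact parent_ne hxr h
          · exact hx (hD _ h (T.mem_subtree_parent x)))
        (by omega)
      have h3 := ((Trek.refl hT).up hxr).trans ht
      exact ⟨T', _, _, hr, hs, h3, by omega, by omega⟩

theorem exists_narrow [Finite V] (hS : S.IsTree) {T : RootedTree V} (h : IsTwoCut S T) :
    ∃ (T' : RootedTree V) (m k : ℕ), T'.root = T.root ∧
      (∀ a, (boundary S T' a).Subsingleton) ∧ Trek S (T, T.root) (T', T.root) m k ∧
      m ≤ 4 * Nat.card V ∧ k ≤ (wide S T).ncard := by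
  refine exists_trek_narrow hS T.root _ T T.root ∅ h rfl ?_ (by simp) (by simp) (by simp) ?_
  · intro a ha
    rw [root_mem_subtree.1 ha, boundary_root]
    exact Set.subsingleton_empty
  · have := Set.ncard_le_card (wide S T)
    rw [Set.compl_empty, Set.ncard_univ]
    omega

/-- Neither the root nor a child of it is wide: the boundary of the child contains at most the root.
-/
theorem ncard_wide_add_two_le [Finite V] {T : RootedTree V} (h : IsTwoCut S T)
    (hn : 2 ≤ Nat.card V) : (wide S T).ncard + 2 ≤ Nat.card V := by
  have := Finite.one_lt_card_iff_nontrivial.1 hn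
  obtain ⟨z, hz⟩ := exists_ne T.root
  obtain ⟨c, hc, -⟩ := exists_isChild (T.mem_subtree_root z) hz
  have hsub : wide S T ⊆ ({T.root, c} : Set V)ᶜ := by
    rintro x hx (rfl | rfl)
    · refine hx ?_
      rw [boundary_root]
      exact Set.subsingleton_empty
    · refine hx ?_
      have key : ∀ a ∈ boundary S T x, a = T.root := fun a ha =>
        (h.eq_or_mem_boundary hc ha).resolve_right (by
          rw [boundary_root]; exact Set.notMem_empty a)
      exact fun a ha b hb => (key a ha).trans (key b hb).symm
  have h1 := Set.ncard_le_ncard hsub (Set.toFinite _)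
  have h2 := Set.ncard_add_ncard_compl ({T.root, c} : Set V)
  rw [Set.ncard_pair hc.ne.symm] at h2
  omega

/-- The parent has a neighbour in `T_x`. If that neighbour were in the subtree of a child of `x`,
this child would have both `x` and the parent as boundary nodes and be wide. -/
theorem IsTwoCut.adj_parent {T : RootedTree V} (h : IsTwoCut S T)
    (hs : ∀ a, (boundary S T a).Subsingleton) {x : V} (hx : x ≠ T.root) :
    S.Adj x (T.parent x) := by
  obtain ⟨hp, w, hw, hpw⟩ := h.parent_mem_boundary hx
  rcases eq_or_moves hw hpw with rfl | ⟨c, hc, hwc⟩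
  · exact hpw.symm
  · have hb := h.parent_mem_boundary hc.1.1
    rw [hc.1.2] at hb
    have := hs c hb ⟨fun hpc => hp (subtree_subset hc.1.mem_subtree hpc), w, hwc, hpw⟩
    exact absurd this.symm (parent_ne hx)

theorem link_root_of_adj_parent {T : RootedTree V} (h : ∀ x, x ≠ T.root → S.Adj x (T.parent x))
    (x : V) : Link S (T.searchPath x) x T.root := by
  induction x using parent_induction (T := T) with
  | hroot => exact Link.refl
  | h x hx ih =>
    rw [searchPath_eq_insert]
    have hp : T.parent x ∈ T.searchPath (T.parent x) := T.self_mem_subtree _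
    exact (Link.single (h x hx) (Set.mem_insert _ _) (Set.mem_insert_of_mem _ hp)).trans
      (ih.mono (Set.subset_insert _ _))

/-- There is only one two-cut search tree without wide nodes that has a given root. -/
theorem IsTwoCut.ext_of_narrow (hS : S.IsTree) {T T' : RootedTree V} (h : IsTwoCut S T)
    (h' : IsTwoCut S T') (hs : ∀ a, (boundary S T a).Subsingleton)
    (hs' : ∀ a, (boundary S T' a).Subsingleton) (hr : T.root = T'.root) : T = T' := by
  refine RootedTree.ext hr (funext fun x => ?_)
  by_cases hx : x = T.root
  · rw [hx, T.parent_root, hr, T'.parent_root]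
  have hx' : x ≠ T'.root := hr ▸ hx
  -- In either tree, the parent of `x` is the neighbour of `x` on the side of the root, and there is
  -- only one such neighbour.
  have key : ∀ T : RootedTree V, IsTwoCut S T → (∀ a, (boundary S T a).Subsingleton) →
      x ≠ T.root → Link S {x}ᶜ (T.parent x) T.root := fun T h hs hx =>
    (link_root_of_adj_parent (fun y hy => h.adj_parent hs hy) _).mono fun z hz => by
      rintro rfl
      exact notMem_searchPath_parent hx hz
  have h1 := key T h hs hx
  rw [hr] at h1
  exact (h1.trans (key T' h' hs' hx').symm).eq_of_adj hS.isAcyclic (by simp)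
    (h.adj_parent hs hx) (h'.adj_parent hs' hx')

theorem exists_trek [Finite V] (hS : S.IsTree) {T T' : RootedTree V} (h : IsTwoCut S T)
    (h' : IsTwoCut S T') : ∃ (y : V) (m k : ℕ), Trek S (T, T.root) (T', y) m k ∧
      m ≤ 28 * Nat.card V ∧ (2 ≤ Nat.card V → k + 5 ≤ 3 * Nat.card V) := by
  obtain ⟨m₀, t₀, hm₀⟩ := trek_from_root h' T.root
  have hle := Set.ncard_le_card (T'.searchPath T.root)
  obtain ⟨d, hd⟩ : ∃ d, (T'.searchPath T.root).ncard = d + 1 :=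
    Nat.exists_eq_succ_of_ne_zero ((Set.ncard_pos (s := T'.searchPath T.root)
      (Set.toFinite _)).2 ⟨T.root, T'.self_mem_subtree T.root⟩).ne'
  obtain ⟨U', hr, m₁, hm₁, t₁⟩ := exists_trek_to_root hS T.root d T' h' hd
  have hU' := t₁.isTwoCut
  obtain ⟨W', m₂, k₂, hr', hs', t₂, hm₂, hk₂⟩ := exists_narrow hS hU'
  obtain ⟨W, m₃, k₃, hr₃, hs₃, t₃, hm₃, hk₃⟩ := exists_narrow hS h
  obtain rfl : W = W' := t₃.isTwoCut.ext_of_narrow hS t₂.isTwoCut hs₃ hs'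
    (hr₃.trans (hr'.trans hr).symm)
  have hrU : ((U', T.root).1 : RootedTree V).root = T.root := hr
  rw [hrU] at t₂
  obtain ⟨m₄, hm₄, t₄⟩ := ((t₀.trans t₁).trans t₂).reverse
  -- On the side of `T'`, walking to `r`, making it the root and the tour take at most `n + 3n + 4n`
  -- steps. Reversal triples this, and the tour from `T` adds `4n`, hence 28. Rotations number `k₃ +
  -- d + k₂` with `d ≤ n - 1` and `k₂`, `k₃` at most `n - 2`.
  refine ⟨_, _, _, t₃.trans t₄, by omega, fun hn => ?_⟩
  have h₁ := ncard_wide_add_two_le h hn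
  have h₂ := ncard_wide_add_two_le hU' hn
  dsimp only at h₂ hk₂
  omega

end STT

theorem mainTheorem6 :
    ∃ C : ℕ, ∀ (V : Type*) [Fintype V] (S : SimpleGraph V), S.IsTree →
      ∀ T T' : STT.RootedTree V, STT.IsSteinerClosedSTT S T → STT.IsSteinerClosedSTT S T' →
        (2 ≤ Fintype.card V →
          ∃ (m : ℕ) (R : ℕ → STT.RootedTree V),
            (m : ℤ) ≤ 3 * (Fintype.card V : ℤ) - 5 ∧
            R 0 = T ∧ R m = T' ∧
            (∀ i < m, ∃ x, STT.IsRotation S (R i) x (R (i + 1))) ∧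
            (∀ i ≤ m, STT.IsSteinerClosedSTT S (R i))) ∧
        (∃ (m : ℕ) (R : ℕ → STT.RootedTree V × V),
            m ≤ C * Fintype.card V ∧
            R 0 = (T, T.root) ∧ (R m).1 = T' ∧
            (∀ i < m, STT.PointerStep S (R i) (R (i + 1))) ∧
            (∀ i ≤ m, STT.IsSteinerClosedSTT S (R i).1)) := by
  refine ⟨28, fun V _ S hS T T' hT hT' => ?_⟩
  obtain ⟨y, m, k, ht, hm, hk⟩ := STT.exists_trek hS ((STT.isSteinerClosedSTT_iff hS).1 hT)
    ((STT.isSteinerClosedSTT_iff hS).1 hT')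
  rw [Nat.card_eq_fintype_card] at hm hk
  constructor
  · intro hn
    obtain ⟨R, h0, h1, h2, h3⟩ := ht.exists_rotations hS
    have := hk hn
    exact ⟨k, R, by omega, h0, h1, h2, h3⟩
  · obtain ⟨R, h0, h1, h2, h3⟩ := ht.exists_pointerSteps hS
    exact ⟨m, R, hm, h0, by rw [h1], h2, h3⟩
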